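/- Throughout, a *smooth $\mathbb R$-variety* is a nonsingular, separated real algebraic variety in the sense of spaces of real points: a (Zariski) topological space with a sheaf of real-valued regular functions which has a finite cover by open subsets isomorphic to nonsingular Zariski-locally-closed subsets of some $\mathbb R^n$ with their regular functions. Let $\mathrm{Var}_{\mathbb R}$ be the category of smooth $\mathbb R$-varieties, with regular maps as morphisms. The group $\mathbb R/\pi:=\mathbb R/\pi\mathbb Z$ is regarded as a variety via the bijection $\mathbb P^1(\mathbb R)\to\mathbb R/\pi$, $[x,y]\mapsto \mathrm{Arg}(x+y\mathbf i)\bmod \pi$, and $\mathbb C$, $\mathbb C^3$ and $\mathbb P^2(\mathbb C)$ are regarded as real varieties. Put $\mathrm X=\{(a,b,c)\in\mathbb C^3: a+b+c=0\}$, let $\mathbb P(\mathrm X)\subset\mathbb P^2(\mathbb C)$ be its complex projectivization, and put $\mathsf T=\{(\alpha,\beta,\gamma)\in(\mathbb R/\pi)^3:\alpha+\beta+\gamma=0\}$. *Triangles.* Let $\mathfrak T\subset\Omega_{\mathfrak T}:=\mathbb C\times\mathrm X\times\mathbb P^5(\mathbb R)\times(\mathbb R/\pi)^3$ be the set of labeled,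 oriented, possibly-degenerate triangles, that is, of tuples $$\big(B_0;(a,b,c);[a_1,a_2,b_1,b_2,c_1,c_2];(\xi_a,\xi_b,\xi_c)\big)$$ such that: if $(a,b,c)\ne 0$, then $[a_1,a_2,b_1,b_2,c_1,c_2]=[\mathrm{re}\,a,\mathrm{im}\,a,\mathrm{re}\,b,\mathrm{im}\,b,\mathrm{re}\,c,\mathrm{im}\,c]$; if $(a,b,c)=0$, then $a_1+b_1+c_1=a_2+b_2+c_2=0$; and if $a_1+a_2\mathbf i\neq0$, then $\xi_a=\mathrm{Arg}(a_1+a_2\mathbf i)\bmod\pi$, and similarly for $\xi_b$ and $\xi_c$ (the argument of a zero pair is arbitrary). *Triangle classes.* Let $\mathfrak D\subset\Omega_{\mathfrak D}:=\mathbb P(\mathrm X)\times\mathsf T$ be the set of similarity classes of such triangles, that is, of all pairs $\big([a_1+a_2\mathbf i,b_1+b_2\mathbf i,c_1+c_2\mathbf i];(\xi_b-\xi_c,\xi_c-\xi_a,\xi_a-\xi_b)\big)$ obtained from elements of $\mathfrak T$. *Families.* For a smooth $\mathbb R$-variety $B$ let $\mathscr F_{\mathfrak T}(B)$ (resp. $\mathscr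 F_{\mathfrak D}(B)$) be the set of families over $B$, i.e. of morphisms $B\to\Omega_{\mathfrak T}$ with image in $\mathfrak T$ (resp. $B\to\Omega_{\mathfrak D}$ with image in $\mathfrak D$); a morphism $m:B\to C$ acts by the pullback $f\mapsto f\circ m$. This defines contravariant functors $\mathscr F_{\mathfrak T}$ and $\mathscr F_{\mathfrak D}$ from $\mathrm{Var}_{\mathbb R}$ to sets. **Theorem.** With the structures induced from $\Omega_{\mathfrak T}$ and $\Omega_{\mathfrak D}$, the sets $\mathfrak T$ and $\mathfrak D$ are smooth $\mathbb R$-varieties, and they represent $\mathscr F_{\mathfrak T}$ and $\mathscr F_{\mathfrak D}$, respectively, so that the inclusions $\mathfrak T\hookrightarrow\Omega_{\mathfrak T}$ and $\mathfrak D\hookrightarrow\Omega_{\mathfrak D}$ are universal families. Consequently $\mathfrak T$ and $\mathfrak D$ are fine moduli spaces: every family over a smooth $\mathbb R$-variety $B$ is the pullback of the universal family along a unique morphism from $B$, and, for every smooth $\mathbb R$-variety $E$, every natural transformation $\mathscr F_{\mathfrak T}\to\mathrm{Hom}(-,E)$ (resp. $\mathscr F_{\mathfrak D}\to\mathrm{Hom}(-,E)$)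 factors uniquely through the isomorphism $\mathscr F_{\mathfrak T}\cong\mathrm{Hom}(-,\mathfrak T)$ (resp. $\mathscr F_{\mathfrak D}\cong\mathrm{Hom}(-,\mathfrak D)$). -/

import Mathlib

open CategoryTheory Opposite Topology
open scoped LinearAlgebra.Projectivization

namespace TriangleModuli

/-! ## Spaces with real-valued regular functions -/

/-- A space with functions over `ℝ`: a (Zariski) topological space together with a sheaf of
`ℝ`-algebras of real-valued functions whose stalks are local rings. `Reg f x` says that the germ of
`f` at `x` is regular; the sheaf assigns to an open set `U` the functions `f` on `U` with `Reg f x`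
for all `x ∈ U`. The values of `f` away from `x` do not matter, by `reg_congr`. -/
structure RSpace where
  carrier : Type
  top : TopologicalSpace carrier
  Reg : (carrier → ℝ) → carrier → Prop
  reg_congr : ∀ {f g : carrier → ℝ} {x : carrier}, (∀ᶠ y in 𝓝 x, f y = g y) → Reg f x → Reg g x
  reg_eventually : ∀ {f : carrier → ℝ} {x : carrier}, Reg f x → ∀ᶠ y in 𝓝 x, Reg f y
  reg_const : ∀ (c : ℝ) (x : carrier), Reg (fun _ => c) x
  reg_add : ∀ {f g : carrier → ℝ} {x : carrier}, Reg f x → Reg g x → Reg (fun y => f y + g y) x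
  reg_mul : ∀ {f g : carrier → ℝ} {x : carrier}, Reg f x → Reg g x → Reg (fun y => f y * g y) x
  reg_ne_zero : ∀ {f : carrier → ℝ} {x : carrier}, Reg f x → f x ≠ 0 → ∀ᶠ y in 𝓝 x, f y ≠ 0
  reg_inv : ∀ {f : carrier → ℝ} {x : carrier}, Reg f x → f x ≠ 0 → Reg (fun y => (f y)⁻¹) x

instance : CoeSort RSpace Type := ⟨RSpace.carrier⟩

instance (X : RSpace) : TopologicalSpace X := X.top

/-- A morphism of spaces with functions: a continuous map pulling regular functions back to regular
functions. -/
@[ext]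
structure RSpace.Hom (X Y : RSpace) where
  toFun : X → Y
  continuous_toFun : Continuous toFun
  reg_comp : ∀ (x : X) (f : Y → ℝ), Y.Reg f (toFun x) → X.Reg (fun x' => f (toFun x')) x

instance : Category RSpace where
  Hom := RSpace.Hom
  id X := ⟨fun x => x, continuous_id, fun _ _ h => h⟩
  comp f g := ⟨fun x => g.toFun (f.toFun x), g.continuous_toFun.comp f.continuous_toFun,
    fun x h hh => f.reg_comp x _ (g.reg_comp (f.toFun x) h hh)⟩

namespace RSpace

/-- The underlying map of points of a morphism. -/
def onPoints {X Y : RSpace} (f : X ⟶ Y) : X → Y := Hom.toFun f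

/-- The space with functions generated by algebras of functions `A x` (`x : X`) on a topological
space `(X, t)`, where the members of `A x` are thought of as regular near `x`: the topology is
generated by the non-vanishing loci of such functions, and a function is regular at `x` if near `x`
it is a quotient `a / b` with `a b ∈ A x` and `b x ≠ 0`. -/
def generate (X : Type) (t : TopologicalSpace X) (A : X → Subalgebra ℝ (X → ℝ))
    (hA : ∀ x, ∀ f ∈ A x, ∃ U : Set X, IsOpen[t] U ∧ x ∈ U ∧ ∀ y ∈ U, f ∈ A y) : RSpace :=
  let τ : TopologicalSpace X := .generateFrom
    {W | ∃ (U : Set X) (q : X → ℝ), IsOpen[t] U ∧ (∀ y ∈ U, q ∈ A y) ∧ W = {y | y ∈ U ∧ q y ≠ 0}}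
  have key : ∀ x, ∀ f ∈ A x, f x ≠ 0 → ∀ᶠ y in @nhds X τ x, f ∈ A y ∧ f y ≠ 0 := by
    intro x f hf hx
    obtain ⟨U, hU, hxU, hfU⟩ := hA x f hf
    have hopen : IsOpen[τ] {y | y ∈ U ∧ f y ≠ 0} :=
      .basic _ ⟨U, f, hU, hfU, rfl⟩
    filter_upwards [@IsOpen.mem_nhds X τ x _ hopen ⟨hxU, hx⟩] with y hy
    exact ⟨hfU y hy.1, hy.2⟩
  have key' : ∀ x, ∀ f ∈ A x, ∀ᶠ y in @nhds X τ x, f ∈ A y := by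
    intro x f hf
    obtain ⟨U, hU, hxU, hfU⟩ := hA x f hf
    have hopen : IsOpen[τ] {y | y ∈ U ∧ (1 : X → ℝ) y ≠ 0} :=
      .basic _ ⟨U, 1, hU, fun y _ => one_mem _, rfl⟩
    filter_upwards [@IsOpen.mem_nhds X τ x _ hopen ⟨hxU, by simp⟩] with y hy
    exact hfU y hy.1
  { carrier := X
    top := τ
    Reg := fun f x => ∃ a ∈ A x, ∃ b ∈ A x, b x ≠ 0 ∧ ∀ᶠ y in @nhds X τ x, f y = a y / b y
    reg_congr := by
      rintro f g x hfg ⟨a, ha, b, hb, hbx, h⟩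
      refine ⟨a, ha, b, hb, hbx, ?_⟩
      filter_upwards [hfg, h] with y h1 h2
      rw [← h1, h2]
    reg_eventually := by
      rintro f x ⟨a, ha, b, hb, hbx, h⟩
      filter_upwards [key' x a ha, key x b hb hbx, eventually_eventually_nhds.2 h] with y h1 h2 h3
      exact ⟨a, h1, b, h2.1, h2.2, h3⟩
    reg_const := fun c x => ⟨algebraMap ℝ (X → ℝ) c, (A x).algebraMap_mem c, 1, one_mem _,
      by simp, by simp⟩
    reg_add := by
      rintro f g x ⟨a, ha, b, hb, hbx, h⟩ ⟨c, hc, d, hd, hdx, h'⟩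
      refine ⟨a * d + b * c, add_mem (mul_mem ha hd) (mul_mem hb hc), b * d, mul_mem hb hd,
        mul_ne_zero hbx hdx, ?_⟩
      filter_upwards [h, h', key x b hb hbx, key x d hd hdx] with y h1 h2 h3 h4
      rw [h1, h2, div_add_div _ _ h3.2 h4.2]
      rfl
    reg_mul := by
      rintro f g x ⟨a, ha, b, hb, hbx, h⟩ ⟨c, hc, d, hd, hdx, h'⟩
      refine ⟨a * c, mul_mem ha hc, b * d, mul_mem hb hd, mul_ne_zero hbx hdx, ?_⟩
      filter_upwards [h, h'] with y h1 h2
      rw [h1, h2, div_mul_div_comm]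
      rfl
    reg_ne_zero := by
      rintro f x ⟨a, ha, b, hb, hbx, h⟩ hfx
      have hax : a x ≠ 0 := by
        rintro h0
        exact hfx (by rw [h.self_of_nhds, h0, zero_div])
      filter_upwards [h, key x a ha hax, key x b hb hbx] with y h1 h2 h3
      rw [h1]
      exact div_ne_zero h2.2 h3.2
    reg_inv := by
      rintro f x ⟨a, ha, b, hb, hbx, h⟩ hfx
      have hax : a x ≠ 0 := by
        rintro h0
        exact hfx (by rw [h.self_of_nhds, h0, zero_div])
      refine ⟨b, hb, a, ha, hax, ?_⟩
      filter_upwards [h] with y h1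
      rw [h1, inv_div] }

/-- Affine space: a real vector space `V` with the Zariski topology. The polynomial functions are
the algebra generated by the linear forms, and a function is regular if it is locally a quotient of
polynomial functions with non-vanishing denominator. -/
def affine (V : Type) [AddCommGroup V] [Module ℝ V] : RSpace :=
  generate V (⊤ : TopologicalSpace V) (fun _ => Algebra.adjoin ℝ {f | ∃ l : V →ₗ[ℝ] ℝ, f = fun v => l v})
    (fun _ _ hf => ⟨Set.univ, @isOpen_univ V ⊤, trivial, fun _ _ => hf⟩)

/-- A subset with the induced structure: regular functions are locally restrictions of regular
functions of the ambient space. -/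
def sub (X : RSpace) (S : Set X) : RSpace where
  carrier := S
  top := inferInstance
  Reg f x := ∃ g : X → ℝ, X.Reg g x ∧ ∀ᶠ y in 𝓝 x, f y = g y
  reg_congr := by
    rintro f g x hfg ⟨h, hh, hfh⟩
    refine ⟨h, hh, ?_⟩
    filter_upwards [hfg, hfh] with y h1 h2
    rw [← h1, h2]
  reg_eventually := by
    rintro f x ⟨h, hh, hfh⟩
    filter_upwards [eventually_eventually_nhds.2 hfh,
      continuous_subtype_val.continuousAt.eventually (X.reg_eventually hh)] with y h1 h2
    exact ⟨h, h2, h1⟩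
  reg_const c x := ⟨_, X.reg_const c x, by simp⟩
  reg_add := by
    rintro f g x ⟨a, ha, h⟩ ⟨b, hb, h'⟩
    refine ⟨_, X.reg_add ha hb, ?_⟩
    filter_upwards [h, h'] with y h1 h2
    rw [h1, h2]
  reg_mul := by
    rintro f g x ⟨a, ha, h⟩ ⟨b, hb, h'⟩
    refine ⟨_, X.reg_mul ha hb, ?_⟩
    filter_upwards [h, h'] with y h1 h2
    rw [h1, h2]
  reg_ne_zero := by
    rintro f x ⟨a, ha, h⟩ hx
    filter_upwards [h, continuous_subtype_val.continuousAt.eventually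
      (X.reg_ne_zero ha (by rwa [← h.self_of_nhds]))] with y h1 h2
    rwa [h1]
  reg_inv := by
    rintro f x ⟨a, ha, h⟩ hx
    refine ⟨_, X.reg_inv ha (by rwa [← h.self_of_nhds]), ?_⟩
    filter_upwards [h] with y h1
    rw [h1]

/-- The quotient structure along a map `φ : X → Y`: a set is open if its preimage is, and a function
is regular at `y` if, over some open neighbourhood of `y`, its pullback to `X` is regular. -/
def quotient (X : RSpace) {Y : Type} (φ : X → Y) : RSpace :=
  let τ : TopologicalSpace Y := .coinduced φ X.top
  have hopen : ∀ {U : Set Y}, IsOpen[τ] U ↔ IsOpen (φ ⁻¹' U) := isOpen_coinduced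
  { carrier := Y
    top := τ
    Reg := fun f y => ∃ U : Set Y, IsOpen[τ] U ∧ y ∈ U ∧
      ∀ x, φ x ∈ U → X.Reg (fun x' => f (φ x')) x
    reg_congr := by
      rintro f g y hfg ⟨U, hU, hy, h⟩
      obtain ⟨W, hW, hWo, hyW⟩ := eventually_nhds_iff.1 hfg
      refine ⟨U ∩ W, IsOpen.inter hU hWo, ⟨hy, hyW⟩, fun x hx => X.reg_congr ?_ (h x hx.1)⟩
      filter_upwards [(hopen.1 hWo).mem_nhds hx.2] with x' hx'
      exact hW _ hx'
    reg_eventually := by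
      rintro f y ⟨U, hU, hy, h⟩
      filter_upwards [IsOpen.mem_nhds hU hy] with z hz
      exact ⟨U, hU, hz, h⟩
    reg_const := fun c y => ⟨Set.univ, isOpen_univ, trivial, fun x _ => X.reg_const c x⟩
    reg_add := by
      rintro f g y ⟨U, hU, hy, h⟩ ⟨W, hW, hy', h'⟩
      exact ⟨U ∩ W, IsOpen.inter hU hW, ⟨hy, hy'⟩,
        fun x hx => X.reg_add (h x hx.1) (h' x hx.2)⟩
    reg_mul := by
      rintro f g y ⟨U, hU, hy, h⟩ ⟨W, hW, hy', h'⟩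
      exact ⟨U ∩ W, IsOpen.inter hU hW, ⟨hy, hy'⟩,
        fun x hx => X.reg_mul (h x hx.1) (h' x hx.2)⟩
    reg_ne_zero := by
      rintro f y ⟨U, hU, hy, h⟩ hfy
      have ho : IsOpen[τ] {z | z ∈ U ∧ f z ≠ 0} := by
        refine hopen.2 (isOpen_iff_mem_nhds.2 fun x hx => ?_)
        filter_upwards [(hopen.1 hU).mem_nhds hx.1, X.reg_ne_zero (h x hx.1) hx.2] with x' h1 h2
        exact ⟨h1, h2⟩
      filter_upwards [IsOpen.mem_nhds ho ⟨hy, hfy⟩] with z hz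
      exact hz.2
    reg_inv := by
      rintro f y ⟨U, hU, hy, h⟩ hfy
      have ho : IsOpen[τ] {z | z ∈ U ∧ f z ≠ 0} := by
        refine hopen.2 (isOpen_iff_mem_nhds.2 fun x hx => ?_)
        filter_upwards [(hopen.1 hU).mem_nhds hx.1, X.reg_ne_zero (h x hx.1) hx.2] with x' h1 h2
        exact ⟨h1, h2⟩
      exact ⟨_, ho, ⟨hy, hfy⟩, fun x hx => X.reg_inv (h x hx.1) hx.2⟩ }

/-- Polynomial expressions in functions regular at the two components of `p`. -/
def prodAlg (X Y : RSpace) (p : X × Y) : Subalgebra ℝ (X × Y → ℝ) :=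
  Algebra.adjoin ℝ ({h | ∃ f : X → ℝ, X.Reg f p.1 ∧ h = fun z => f z.1} ∪
    {h | ∃ g : Y → ℝ, Y.Reg g p.2 ∧ h = fun z => g z.2})

theorem prodAlg_open (X Y : RSpace) (p : X × Y) (h : X × Y → ℝ) (hh : h ∈ prodAlg X Y p) :
    ∃ U : Set (X × Y), IsOpen U ∧ p ∈ U ∧ ∀ y ∈ U, h ∈ prodAlg X Y y := by
  suffices H : ∀ᶠ y in 𝓝 p, h ∈ prodAlg X Y y by
    obtain ⟨U, hU, hUo, hp⟩ := eventually_nhds_iff.1 H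
    exact ⟨U, hUo, hp, hU⟩
  induction hh using Algebra.adjoin_induction with
  | mem h hh =>
    rcases hh with ⟨f, hf, rfl⟩ | ⟨g, hg, rfl⟩
    · filter_upwards [continuous_fst.continuousAt.eventually (X.reg_eventually hf)] with y hy
      exact Algebra.subset_adjoin (Or.inl ⟨f, hy, rfl⟩)
    · filter_upwards [continuous_snd.continuousAt.eventually (Y.reg_eventually hg)] with y hy
      exact Algebra.subset_adjoin (Or.inr ⟨g, hy, rfl⟩)
  | algebraMap r => exact Filter.Eventually.of_forall fun y => (prodAlg X Y y).algebraMap_mem r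
  | add f g _ _ hf hg =>
    filter_upwards [hf, hg] with y h1 h2
    exact add_mem h1 h2
  | mul f g _ _ hf hg =>
    filter_upwards [hf, hg] with y h1 h2
    exact mul_mem h1 h2

/-- The product: its topology is generated by the non-vanishing loci, in products of open sets, of
polynomial expressions `∑ fᵢ(x) gᵢ(y)` in regular functions of the factors, and its regular
functions are locally quotients of such expressions. -/
def prod (X Y : RSpace) : RSpace :=
  generate (X × Y) inferInstance (prodAlg X Y) (prodAlg_open X Y)

/-- Projective space `ℙ(V)` over `K` (`K = ℝ` or `ℂ`) as a space with functions over `ℝ`: the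
quotient of `V ∖ {0}`. -/
def projective (K V : Type) [DivisionRing K] [AddCommGroup V] [Module K V] [Module ℝ V] : RSpace :=
  quotient (sub (affine V) {v : V | v ≠ 0})
    (fun v : {v : V // v ≠ 0} => Projectivization.mk K v.1 v.2)

/-! ## Smooth real varieties -/

/-- The subset of `ℝⁿ` where the polynomials `P₁, …, Pₖ` vanish and `q` does not. -/
def locus {n k : ℕ} (P : Fin k → MvPolynomial (Fin n) ℝ) (q : MvPolynomial (Fin n) ℝ) :
    Set (Fin n → ℝ) :=
  {x | (∀ i, MvPolynomial.eval x (P i) = 0) ∧ MvPolynomial.eval x q ≠ 0}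

/-- `X` is isomorphic to a Zariski-open subset of a real algebraic set in some `ℝⁿ` that is defined
there by equations `P₁ = ⋯ = Pₖ = 0` with everywhere linearly independent gradients. (Every
Zariski-open subset of `ℝⁿ` is the non-vanishing locus of a single polynomial `q`.) -/
def IsSmoothAffine (X : RSpace) : Prop :=
  ∃ (n k : ℕ) (P : Fin k → MvPolynomial (Fin n) ℝ) (q : MvPolynomial (Fin n) ℝ),
    (∀ x ∈ locus P q, LinearIndependent ℝ
      (fun (i : Fin k) (j : Fin n) => MvPolynomial.eval x (MvPolynomial.pderiv j (P i)))) ∧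
    Nonempty (X ≅ sub (affine (Fin n → ℝ)) (locus P q))

/-- A smooth (that is, nonsingular) real algebraic variety: a separated space with functions with a
finite cover by open subsets that are isomorphic to nonsingular real algebraic sets. -/
def IsSmoothVariety : ObjectProperty RSpace := fun X =>
  IsClosed {p : prod X X | (show X × X from p).1 = (show X × X from p).2} ∧
  ∃ (m : ℕ) (U : Fin m → Set X), (∀ i, IsOpen (U i)) ∧ (∀ x, ∃ i, x ∈ U i) ∧
    ∀ i, IsSmoothAffine (sub X (U i))

end RSpace

/-- The category of smooth `ℝ`-varieties. -/
abbrev SmoothVar := RSpace.IsSmoothVariety.FullSubcategory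

/-! ## Triangles and triangle classes -/

/-- The principal argument modulo `π`. -/
noncomputable def argModPi (z : ℂ) : AddCircle Real.pi := (Complex.arg z : AddCircle Real.pi)

theorem argModPi_real_mul (t : ℝ) (ht : t ≠ 0) (z : ℂ) : argModPi (t * z) = argModPi z := by
  have hneg : ∀ w : ℂ, argModPi (-w) = argModPi w := by
    intro w
    by_cases hw : w = 0
    · simp [hw]
    have h := Complex.arg_neg_coe_angle hw
    rw [← Real.Angle.coe_add, Real.Angle.angle_eq_iff_two_pi_dvd_sub] at h
    obtain ⟨k, hk⟩ := h
    refine QuotientAddGroup.eq_iff_sub_mem.2 (AddSubgroup.mem_zmultiples_iff.2 ⟨2 * k + 1, ?_⟩)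
    simp only [zsmul_eq_mul, Int.cast_add, Int.cast_mul, Int.cast_ofNat, Int.cast_one]
    linarith
  rcases lt_or_gt_of_ne ht with h | h
  · rw [← hneg]
    have : -((t : ℂ) * z) = ((-t : ℝ) : ℂ) * z := by push_cast; ring
    rw [this, argModPi, Complex.arg_real_mul z (neg_pos.2 h), argModPi]
  · rw [argModPi, Complex.arg_real_mul z h, argModPi]

/-- The bijection `ρ : ℙ¹(ℝ) → ℝ/π`, `[x, y] ↦ Arg(x + yi) mod π`. -/
noncomputable def rho : ℙ ℝ (Fin 2 → ℝ) → AddCircle Real.pi :=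
  Projectivization.lift (fun v => argModPi (Complex.mk (v.1 0) (v.1 1))) (by
    rintro ⟨v, hv⟩ ⟨w, hw⟩ t h
    have ht : t ≠ 0 := by
      rintro rfl
      exact hv (by simpa using h)
    have e : Complex.mk (v 0) (v 1) = (t : ℂ) * Complex.mk (w 0) (w 1) := by
      have h' : v = t • w := h
      apply Complex.ext <;> simp [h']
    change argModPi (Complex.mk (v 0) (v 1)) = argModPi (Complex.mk (w 0) (w 1))
    rw [e, argModPi_real_mul t ht])

/-- `ℝ/π` as a real variety, with the structure transported from `ℙ¹(ℝ)` along `ρ`. -/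
noncomputable def circle : RSpace := (RSpace.projective ℝ (Fin 2 → ℝ)).quotient rho

/-- `(ℝ/π)³`. -/
noncomputable def circle3 : RSpace := circle.prod (circle.prod circle)

/-- The plane `V(X + Y + Z) ⊂ ℂ³` of side-vectors `(a, b, c)`. -/
abbrev SideVectors : Type := {s : Fin 3 → ℂ // s 0 + s 1 + s 2 = 0}

noncomputable def sideVectors : RSpace :=
  (RSpace.affine (Fin 3 → ℂ)).sub {s : Fin 3 → ℂ | s 0 + s 1 + s 2 = 0}

/-- The ambient space `ℂ × V(X + Y + Z) × ℙ⁵(ℝ) × (ℝ/π)³` of the triangles. Its points are the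
tuples `(B₀; (a, b, c); [a₁, a₂, b₁, b₂, c₁, c₂]; (ξ₁, ξ₂, ξ₃))`. -/
noncomputable def triangleAmbient : RSpace :=
  (RSpace.affine ℂ).prod (sideVectors.prod ((RSpace.projective ℝ (Fin 6 → ℝ)).prod circle3))

/-- The real coordinates `(re a, im a, re b, im b, re c, im c)` of `(a, b, c) ∈ ℂ³`. -/
def realCoords (s : Fin 3 → ℂ) : Fin 6 → ℝ :=
  ![(s 0).re, (s 0).im, (s 1).re, (s 1).im, (s 2).re, (s 2).im]

/-- The vector `(v₀ + v₁i, v₂ + v₃i, v₄ + v₅i) ∈ ℂ³` with the given real coordinates. -/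
def complexCoords (v : Fin 6 → ℝ) : Fin 3 → ℂ := ![⟨v 0, v 1⟩, ⟨v 2, v 3⟩, ⟨v 4, v 5⟩]

/-- The conditions for `(B₀; s; p; (ξ₁, ξ₂, ξ₃))`, with side-vectors `s = (a, b, c)`, `a + b + c = 0`,
and `p = [a₁, a₂, b₁, b₂, c₁, c₂]`, to be a labeled, oriented, possibly-degenerate triangle. There is
no condition on the basepoint, nor on an argument `ξ` whose pair in `p` is zero. -/
def IsTriangle (s : Fin 3 → ℂ) (p : ℙ ℝ (Fin 6 → ℝ)) (ξ₁ ξ₂ ξ₃ : AddCircle Real.pi) : Prop :=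
  (s ≠ 0 → ∃ h : realCoords s ≠ 0, p = Projectivization.mk ℝ (realCoords s) h) ∧
  ∃ (v : Fin 6 → ℝ) (hv : v ≠ 0), p = Projectivization.mk ℝ v hv ∧
    (s = 0 → v 0 + v 2 + v 4 = 0 ∧ v 1 + v 3 + v 5 = 0) ∧
    (complexCoords v 0 ≠ 0 → ξ₁ = argModPi (complexCoords v 0)) ∧
    (complexCoords v 1 ≠ 0 → ξ₂ = argModPi (complexCoords v 1)) ∧
    (complexCoords v 2 ≠ 0 → ξ₃ = argModPi (complexCoords v 2))

/-- The set `𝔗` of labeled, oriented, possibly-degenerate triangles. -/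
def triangles : Set (ℂ × SideVectors × ℙ ℝ (Fin 6 → ℝ) ×
    AddCircle Real.pi × AddCircle Real.pi × AddCircle Real.pi) :=
  {(_, s, p, ξ₁, ξ₂, ξ₃) | IsTriangle s.1 p ξ₁ ξ₂ ξ₃}

/-- `ℙ(V(X + Y + Z)) ⊂ ℙ²(ℂ)`. -/
def projSideSet : Set (ℙ ℂ (Fin 3 → ℂ)) :=
  {c | ∃ (s : Fin 3 → ℂ) (hs : s ≠ 0), c = Projectivization.mk ℂ s hs ∧ s 0 + s 1 + s 2 = 0}

noncomputable def projSideVectors : RSpace := (RSpace.projective ℂ (Fin 3 → ℂ)).sub projSideSet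

/-- The torus `V(P + Q + R) ⊂ (ℝ/π)³`. -/
def torusSet : Set (AddCircle Real.pi × AddCircle Real.pi × AddCircle Real.pi) :=
  {(α, β, γ) | α + β + γ = 0}

noncomputable def torus : RSpace := circle3.sub torusSet

/-- The ambient space of the triangle classes. -/
noncomputable def classAmbient : RSpace := projSideVectors.prod torus

/-- `(c; α, β, γ)` is the class `[T]` of the triangle `T = (B₀; s; p; ξ₁, ξ₂, ξ₃)`, that is,
`c = [a₁ + a₂i, b₁ + b₂i, c₁ + c₂i]` and the interior angles of `T` are
`(α, β, γ) = (ξ₂ - ξ₃, ξ₃ - ξ₁, ξ₁ - ξ₂)`. -/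
def IsClassOf (c : ℙ ℂ (Fin 3 → ℂ)) (α β γ : AddCircle Real.pi)
    (p : ℙ ℝ (Fin 6 → ℝ)) (ξ₁ ξ₂ ξ₃ : AddCircle Real.pi) : Prop :=
  (∃ (v : Fin 6 → ℝ) (hv : v ≠ 0) (hw : complexCoords v ≠ 0),
    p = Projectivization.mk ℝ v hv ∧ c = Projectivization.mk ℂ (complexCoords v) hw) ∧
  α = ξ₂ - ξ₃ ∧ β = ξ₃ - ξ₁ ∧ γ = ξ₁ - ξ₂

/-- The set `𝔇` of similarity classes of labeled, oriented, possibly-degenerate triangles. -/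
def triangleClasses : Set (projSideSet × torusSet) :=
  {(c, θ) | ∃ T ∈ triangles,
    IsClassOf c.1 θ.1.1 θ.1.2.1 θ.1.2.2 T.2.2.1 T.2.2.2.1 T.2.2.2.2.1 T.2.2.2.2.2}

/-! ## Families and moduli functors -/

/-- The functor sending a smooth variety `B` to the set of families over `B`, that is, of morphisms
`B → Ω` whose image is in the set `S`, and a morphism `m` to the pullback `f ↦ f ∘ m`. -/
def familyFunctor (Ω : RSpace) (S : Set Ω) : SmoothVarᵒᵖ ⥤ Type where
  obj B := {f : B.unop.obj ⟶ Ω // ∀ b, RSpace.onPoints f b ∈ S}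
  map m := TypeCat.ofHom fun f => ⟨m.unop.hom ≫ f.1, fun b => f.2 (RSpace.onPoints m.unop.hom b)⟩

/-- The tautological family over `S` itself, for a set `S ⊆ Ω` that is a smooth variety with the
induced structure: the inclusion `S → Ω`. -/
def tautologicalFamily (Ω : RSpace) (S : Set Ω) (h : (Ω.sub S).IsSmoothVariety) :
    (familyFunctor Ω S).obj (op ⟨Ω.sub S, h⟩) :=
  ⟨RSpace.Hom.mk Subtype.val continuous_subtype_val
    (fun _ f hf => ⟨f, hf, Filter.Eventually.of_forall fun _ => rfl⟩), fun b => b.2⟩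

/-- `M` represents `F` with universal family `u ∈ F(M)`, and so is a fine moduli space for `F`: there
are natural bijections `Hom(B, M) ≃ F(B)` under which `u` corresponds to the identity, every family
is the pullback of `u` along a unique morphism, and every natural transformation from `F` to a
functor `Hom(-, E)` factors uniquely through `F ≅ Hom(-, M)`. -/
def IsFineModuliSpace (F : SmoothVarᵒᵖ ⥤ Type) (M : SmoothVar) (u : F.obj (op M)) : Prop :=
  ∃ R : F.RepresentableBy M,
    R.homEquiv (𝟙 M) = u ∧
    (∀ (B : SmoothVar) (f : F.obj (op B)), ∃! m : B ⟶ M, F.map m.op u = f) ∧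
    (∀ (E : SmoothVar) (Ψ : F ⟶ yoneda.obj E),
      ∃! Φ : yoneda.obj M ⟶ yoneda.obj E, R.toIso.inv ≫ Φ = Ψ)

/-- The moduli functor of triangles. -/
noncomputable abbrev triangleFunctor : SmoothVarᵒᵖ ⥤ Type :=
  familyFunctor triangleAmbient triangles

/-- The moduli functor of triangle classes. -/
noncomputable abbrev classFunctor : SmoothVarᵒᵖ ⥤ Type :=
  familyFunctor classAmbient triangleClasses

/-- The space of triangles `𝔗`, with the structure induced from the ambient space. -/
noncomputable abbrev triangleSpace : RSpace := triangleAmbient.sub triangles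

/-- The space of triangle classes `𝔇`, with the structure induced from the ambient space. -/
noncomputable abbrev classSpace : RSpace := classAmbient.sub triangleClasses

end TriangleModuli

/-!
Since `𝔗` and `𝔇` carry the structures induced from their ambient spaces, a family over `B` is the
same thing as a morphism from `B` to `𝔗` or `𝔇`, so representability is automatic once they are
known to be smooth varieties. The ambient spaces are separated because regular functions separate
their points. For smoothness, every triangle with a nonzero shape `w` has two sides `w (i + 1)`,
`w (i + 2)` that do not vanish. The remaining side is `r` times a vector of slope `m`, and `m` is
determined by its argument even where the side vanishes. Thus `r`, `m` and the slope of `w (i + 1)`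
are coordinates on the shapes with arguments, with the condition that the side `w (i + 2)` closing
up the triangle be nonzero, and together with the basepoint and the scale of the side vectors they
identify open subsets of `𝔗` with Zariski-open subsets of `ℝ⁶`. For similarity classes, one
normalizes `w (i + 1) = 1`, and `r` and `m` identify open subsets of `𝔇` with Zariski-open subsets
of `ℝ²`.
-/

namespace TriangleModuli

namespace RSpace

section Reg

variable {X : RSpace} {x : X}

theorem reg_neg {f : X → ℝ} (hf : X.Reg f x) : X.Reg (fun y => -f y) x := by
  simpa using X.reg_mul (X.reg_const (-1) x) hf

theorem reg_sub {f g : X → ℝ} (hf : X.Reg f x) (hg : X.Reg g x) :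
    X.Reg (fun y => f y - g y) x := by
  simpa [sub_eq_add_neg] using X.reg_add hf (reg_neg hg)

theorem reg_div {f g : X → ℝ} (hf : X.Reg f x) (hg : X.Reg g x) (h : g x ≠ 0) :
    X.Reg (fun y => f y / g y) x := by
  simpa [div_eq_mul_inv] using X.reg_mul hf (X.reg_inv hg h)

theorem reg_sum {ι : Type*} (s : Finset ι) {f : ι → X → ℝ} (hf : ∀ i ∈ s, X.Reg (f i) x) :
    X.Reg (fun y => ∑ i ∈ s, f i y) x := by
  classical
  induction s using Finset.induction_on with
  | empty => simpa using X.reg_const 0 x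
  | insert a s ha ih =>
    simp only [Finset.sum_insert ha]
    exact X.reg_add (hf a (by simp)) (ih fun i hi => hf i (by simp [hi]))

end Reg

/-- The map `f` is regular at `x`, a pointwise version of being a morphism: it is continuous at `x`
and pulls germs of regular functions at `f x` back to germs of regular functions at `x`. -/
def RegAt (X Y : RSpace) (f : X → Y) (x : X) : Prop :=
  ContinuousAt f x ∧ ∀ g : Y → ℝ, Y.Reg g (f x) → X.Reg (fun y => g (f y)) x

namespace RegAt

variable {X Y Z : RSpace}

theorem id (x : X) : RegAt X X (fun y => y) x := ⟨continuousAt_id, fun _ h => h⟩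

theorem comp {f : X → Y} {g : Y → Z} {x : X} (hg : RegAt Y Z g (f x)) (hf : RegAt X Y f x) :
    RegAt X Z (fun y => g (f y)) x :=
  ⟨ContinuousAt.comp (f := f) hg.1 hf.1, fun k hk => hf.2 _ (hg.2 k hk)⟩

theorem congr {f g : X → Y} {x : X} (hf : RegAt X Y f x) (h : ∀ᶠ y in 𝓝 x, f y = g y) :
    RegAt X Y g x := by
  refine ⟨hf.1.congr h, fun k hk => X.reg_congr (h.mono fun y hy => congrArg k hy) (hf.2 k ?_)⟩
  rwa [h.self_of_nhds]

theorem continuous {f : X → Y} (h : ∀ x, RegAt X Y f x) : Continuous f :=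
  continuous_iff_continuousAt.2 fun x => (h x).1

/-- The morphism given by an everywhere regular map. -/
def hom (f : X → Y) (h : ∀ x, RegAt X Y f x) : X ⟶ Y :=
  Hom.mk f (RegAt.continuous h) fun x => (h x).2

end RegAt

section generate

variable {X : Type} {t : TopologicalSpace X} {A : X → Subalgebra ℝ (X → ℝ)}
  {hA : ∀ x, ∀ f ∈ A x, ∃ U : Set X, IsOpen[t] U ∧ x ∈ U ∧ ∀ y ∈ U, f ∈ A y}

theorem generate_reg {f : X → ℝ} {x : X} (hf : f ∈ A x) : (generate X t A hA).Reg f x :=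
  ⟨f, hf, 1, one_mem _, by simp, by simp⟩

theorem generate_top_le : (generate X t A hA).top ≤ t := fun U hU =>
  .basic _ ⟨U, 1, hU, fun _ _ => one_mem _, by simp; rfl⟩

theorem regAt_generate {Z : RSpace} {h : Z → X} {z : Z} (hc : @ContinuousAt Z X _ t h z)
    (hr : ∀ f ∈ A (h z), Z.Reg (fun y => f (h y)) z) : RegAt Z (generate X t A hA) h z := by
  have hcont : @ContinuousAt Z (generate X t A hA) _ (generate X t A hA).top h z := by
    refine TopologicalSpace.tendsto_nhds_generateFrom_iff.2 ?_
    rintro W ⟨U, q, hU, hq, rfl⟩ ⟨hzU, hqz⟩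
    filter_upwards [hc.preimage_mem_nhds (@IsOpen.mem_nhds X t _ _ hU hzU),
      Z.reg_ne_zero (hr q (hq _ hzU)) hqz] with y h1 h2
    exact ⟨h1, h2⟩
  refine ⟨hcont, ?_⟩
  rintro g ⟨a, ha, b, hb, hbx, hg⟩
  exact Z.reg_congr ((hcont.eventually hg).mono fun _ => Eq.symm) (reg_div (hr a ha) (hr b hb) hbx)

end generate

/-! ## Vector-valued regular maps -/

section affine

variable {X : RSpace} {x : X} {V W : Type} [AddCommGroup V] [Module ℝ V] [AddCommGroup W]
  [Module ℝ W]

theorem regAt_affine_iff {f : X → V} :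
    RegAt X (affine V) f x ↔ ∀ l : V →ₗ[ℝ] ℝ, X.Reg (fun y => l (f y)) x := by
  refine ⟨fun h l => h.2 l (generate_reg (Algebra.subset_adjoin ⟨l, rfl⟩)), fun h => ?_⟩
  refine regAt_generate (t := ⊤) (@Continuous.continuousAt _ _ _ ⊤ _ _ continuous_top) ?_
  intro g hg
  induction hg using Algebra.adjoin_induction with
  | mem g hg =>
    obtain ⟨l, rfl⟩ := hg
    exact h l
  | algebraMap r => exact X.reg_const r x
  | add f g _ _ hf hg => exact X.reg_add hf hg
  | mul f g _ _ hf hg => exact X.reg_mul hf hg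

theorem regAt_real_iff {f : X → ℝ} : RegAt X (affine ℝ) f x ↔ X.Reg f x := by
  rw [regAt_affine_iff]
  refine ⟨fun h => h LinearMap.id, fun h l => ?_⟩
  have hl : ∀ t : ℝ, t * l 1 = l t := fun t => by
    rw [← smul_eq_mul, ← map_smul, smul_eq_mul, mul_one]
  simpa only [hl] using X.reg_mul h (X.reg_const (l 1) x)

theorem regAt_pi_iff {ι : Type} [Finite ι] {f : X → ι → V} :
    RegAt X (affine (ι → V)) f x ↔ ∀ i, RegAt X (affine V) (fun y => f y i) x := by
  classical
  have := Fintype.ofFinite ι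
  simp only [regAt_affine_iff]
  refine ⟨fun h i l => h (l ∘ₗ LinearMap.proj i), fun h l => ?_⟩
  have hl : ∀ v : ι → V, l v = ∑ i, (l ∘ₗ LinearMap.single ℝ (fun _ => V) i) (v i) := fun v => by
    conv_lhs => rw [← Finset.univ_sum_single v, map_sum]
    rfl
  simpa only [hl] using reg_sum _ fun i _ => h i _

namespace RegAt

variable {f g : X → V}

theorem const (v : V) (x : X) : RegAt X (affine V) (fun _ => v) x :=
  regAt_affine_iff.2 fun l => X.reg_const (l v) x

theorem linear (L : V →ₗ[ℝ] W) (hf : RegAt X (affine V) f x) :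
    RegAt X (affine W) (fun y => L (f y)) x :=
  regAt_affine_iff.2 fun l => regAt_affine_iff.1 hf (l ∘ₗ L)

theorem add (hf : RegAt X (affine V) f x) (hg : RegAt X (affine V) g x) :
    RegAt X (affine V) (fun y => f y + g y) x :=
  regAt_affine_iff.2 fun l => by
    simpa only [map_add] using X.reg_add (regAt_affine_iff.1 hf l) (regAt_affine_iff.1 hg l)

theorem neg (hf : RegAt X (affine V) f x) : RegAt X (affine V) (fun y => -f y) x :=
  hf.linear (-LinearMap.id)

theorem sub (hf : RegAt X (affine V) f x) (hg : RegAt X (affine V) g x) :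
    RegAt X (affine V) (fun y => f y - g y) x := by
  simpa only [sub_eq_add_neg] using hf.add hg.neg

theorem eventually_ne_zero (hf : RegAt X (affine V) f x) (h : f x ≠ 0) : ∀ᶠ y in 𝓝 x, f y ≠ 0 := by
  obtain ⟨l, hl⟩ : ∃ l : V →ₗ[ℝ] ℝ, l (f x) ≠ 0 := by
    by_contra! hl
    exact h ((Module.forall_dual_apply_eq_zero_iff ℝ _).1 hl)
  filter_upwards [X.reg_ne_zero (regAt_affine_iff.1 hf l) hl] with y hy hfy
  exact hy (by rw [hfy, map_zero])

/-- A bilinear action is a polynomial map: expand the scalars in a basis. -/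
theorem smul {A : Type} [Ring A] [Algebra ℝ A] [FiniteDimensional ℝ A] [Module A V]
    [IsScalarTower ℝ A V] {c : X → A} (hc : RegAt X (affine A) c x)
    (hf : RegAt X (affine V) f x) : RegAt X (affine V) (fun y => c y • f y) x := by
  refine regAt_affine_iff.2 fun l => ?_
  let b := Module.finBasis ℝ A
  have hl : ∀ (a : A) (v : V),
      l (a • v) = ∑ i, b.coord i a * (l ∘ₗ Algebra.lsmul ℝ ℝ V (b i)) v := fun a v => by
    conv_lhs => rw [← b.sum_repr a, Finset.sum_smul, map_sum]
    simp only [smul_assoc, map_smul, smul_eq_mul, Module.Basis.coord_apply, LinearMap.comp_apply,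
      Algebra.lsmul_coe]
  simpa only [hl] using reg_sum _ fun i _ =>
    X.reg_mul (regAt_affine_iff.1 hc (b.coord i)) (regAt_affine_iff.1 hf _)

variable {K : Type} [RCLike K] {z w : X → K}

theorem mul (hz : RegAt X (affine K) z x) (hw : RegAt X (affine K) w x) :
    RegAt X (affine K) (fun y => z y * w y) x :=
  hz.smul hw

theorem normSq (hz : RegAt X (affine K) z x) : X.Reg (fun y => RCLike.normSq (z y)) x := by
  have hre := regAt_affine_iff.1 hz RCLike.reLm
  have him := regAt_affine_iff.1 hz RCLike.imLm
  exact X.reg_add (X.reg_mul hre hre) (X.reg_mul him him)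

theorem inv (hz : RegAt X (affine K) z x) (h : z x ≠ 0) :
    RegAt X (affine K) (fun y => ((z y)⁻¹ : K)) x := by
  have hinv : ∀ a : K, a⁻¹ = (RCLike.normSq a)⁻¹ • RCLike.conjAe.toLinearMap a := fun a => by
    rw [RCLike.inv_def, RCLike.normSq_eq_def', RCLike.real_smul_eq_coe_mul, mul_comm]
    rfl
  have hn : X.Reg (fun y => (RCLike.normSq (z y))⁻¹) x :=
    X.reg_inv hz.normSq (RCLike.normSq_eq_zero.not.2 h)
  simpa only [hinv] using (regAt_real_iff.2 hn).smul (hz.linear RCLike.conjAe.toLinearMap)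

end RegAt

end affine

/-! ## Maps into and out of the standard constructions -/

namespace RegAt

variable {X Y Z : RSpace}

theorem val {S : Set Y} {f : X → Y.sub S} {x : X} (hf : RegAt X (Y.sub S) f x) :
    RegAt X Y (fun y => (f y).1) x :=
  comp (Y := Y.sub S) (g := Subtype.val)
    ⟨continuous_subtype_val.continuousAt, fun g hg => ⟨g, hg, .of_forall fun _ => rfl⟩⟩ hf

theorem codRestrict {S : Set Y} {f : X → Y.sub S} {x : X} (h : RegAt X Y (fun y => (f y).1) x) :
    RegAt X (Y.sub S) f x := by
  have hc : ContinuousAt f x := Topology.IsInducing.subtypeVal.continuousAt_iff.2 h.1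
  refine ⟨hc, ?_⟩
  rintro g ⟨k, hk, hgk⟩
  exact X.reg_congr ((hc.eventually hgk).mono fun _ => Eq.symm) (h.2 k hk)

theorem fst {f : Z → X × Y} {z : Z} (hf : RegAt Z (X.prod Y) f z) :
    RegAt Z X (fun y => (f y).1) z :=
  comp (Y := X.prod Y) (g := Prod.fst)
    ⟨continuousAt_fst.mono_left (nhds_mono generate_top_le),
      fun g hg => generate_reg (Algebra.subset_adjoin (.inl ⟨g, hg, rfl⟩))⟩ hf

theorem snd {f : Z → X × Y} {z : Z} (hf : RegAt Z (X.prod Y) f z) :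
    RegAt Z Y (fun y => (f y).2) z :=
  comp (Y := X.prod Y) (g := Prod.snd)
    ⟨continuousAt_snd.mono_left (nhds_mono generate_top_le),
      fun g hg => generate_reg (Algebra.subset_adjoin (.inr ⟨g, hg, rfl⟩))⟩ hf

theorem prodMk {f : Z → X} {g : Z → Y} {z : Z} (hf : RegAt Z X f z) (hg : RegAt Z Y g z) :
    RegAt Z (X.prod Y) (fun y => (f y, g y)) z := by
  refine regAt_generate (hf.1.prodMk hg.1) ?_
  intro k hk
  induction hk using Algebra.adjoin_induction with
  | mem k hk =>
    rcases hk with ⟨k, hk, rfl⟩ | ⟨k, hk, rfl⟩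
    · exact hf.2 k hk
    · exact hg.2 k hk
  | algebraMap r => exact Z.reg_const r z
  | add f g _ _ hf hg => exact Z.reg_add hf hg
  | mul f g _ _ hf hg => exact Z.reg_mul hf hg

theorem quotientMap {Y : Type} (φ : X → Y) (x : X) : RegAt X (X.quotient φ) φ x := by
  refine ⟨?_, fun g ⟨_, _, hx, h⟩ => h x hx⟩
  have h : Continuous[X.top, .coinduced φ X.top] φ := continuous_coinduced_rng
  exact @Continuous.continuousAt X Y X.top (.coinduced φ X.top) φ x h

theorem of_quotient {Y : Type} {φ : X → Y} {U : Set Y} (hU : IsOpen (φ ⁻¹' U)) {f : Y → Z}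
    (h : ∀ x, φ x ∈ U → RegAt X Z (fun x' => f (φ x')) x) {y : Y} (hy : y ∈ U) :
    RegAt (X.quotient φ) Z f y := by
  have hopen : ∀ O : Set Z, IsOpen O → IsOpen[(X.quotient φ).top] (U ∩ f ⁻¹' O) := fun O hO =>
    isOpen_coinduced.2 <| isOpen_iff_mem_nhds.2 fun x hx =>
      Filter.inter_mem (hU.mem_nhds hx.1) ((h x hx.1).1.preimage_mem_nhds (hO.mem_nhds hx.2))
  refine ⟨continuousAt_def.2 fun N hN => ?_, fun g hg => ?_⟩
  · obtain ⟨O, hON, hO, hyO⟩ := mem_nhds_iff.1 hN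
    exact mem_nhds_iff.2 ⟨_, fun z hz => hON hz.2, hopen O hO, hy, hyO⟩
  · obtain ⟨O, hO, hOo, hyO⟩ := eventually_nhds_iff.1 (Z.reg_eventually hg)
    exact ⟨_, hopen O hOo, ⟨hy, hyO⟩, fun x hx => (h x hx.1).2 g (hO _ hx.2)⟩

end RegAt

/-! ## Projective spaces -/

section linearForms

variable {K V W : Type} [DivisionRing K] [AddCommGroup V] [Module K V] [AddCommGroup W] [Module K W]

/-- The points of projective space at which the linear map `L` does not vanish. -/
def nonvanishing (L : V →ₗ[K] W) : Set (ℙ K V) := {p | L p.rep ≠ 0}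

theorem mk_mem_nonvanishing {L : V →ₗ[K] W} {v : V} {hv : v ≠ 0} :
    Projectivization.mk K v hv ∈ nonvanishing L ↔ L v ≠ 0 := by
  obtain ⟨a, ha⟩ := Projectivization.exists_smul_eq_mk_rep K v hv
  rw [nonvanishing, Set.mem_ofPred_eq, ← ha, Units.smul_def, map_smul, Ne,
    smul_eq_zero_iff_right a.ne_zero]

/-- The map `[v] ↦ L v / m v` on projective space; it has the value `0` where `m` vanishes. -/
noncomputable def linRatio (L : V →ₗ[K] W) (m : V →ₗ[K] K) (p : ℙ K V) : W :=
  (m p.rep)⁻¹ • L p.rep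

theorem linRatio_mk (L : V →ₗ[K] W) (m : V →ₗ[K] K) {v : V} (hv : v ≠ 0) :
    linRatio L m (Projectivization.mk K v hv) = (m v)⁻¹ • L v := by
  obtain ⟨a, ha⟩ := Projectivization.exists_smul_eq_mk_rep K v hv
  rw [linRatio, ← ha, Units.smul_def, map_smul, map_smul, smul_smul, smul_eq_mul, mul_inv_rev,
    mul_assoc, inv_mul_cancel₀ a.ne_zero, mul_one]

end linearForms

section projective

variable {K V W : Type} [RCLike K] [AddCommGroup V] [Module K V] [Module ℝ V]
  [AddCommGroup W] [Module K W] [Module ℝ W] [IsScalarTower ℝ K W]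

theorem RegAt.projectivizationMk {X : RSpace} {f : X → V} {x : X} (hf : RegAt X (affine V) f x)
    (h0 : ∀ y, f y ≠ 0) :
    RegAt X (projective K V) (fun y => Projectivization.mk K (f y) (h0 y)) x :=
  comp (Y := (affine V).sub {v : V | v ≠ 0}) (Z := projective K V) (f := fun y => ⟨f y, h0 y⟩)
    (g := fun v : {v : V // v ≠ 0} => Projectivization.mk K v.1 v.2) (quotientMap _ _)
    hf.codRestrict

variable [IsScalarTower ℝ K V]

theorem regAt_linear_val (L : V →ₗ[K] W) (v : {v : V // v ≠ 0}) :
    RegAt ((affine V).sub {v : V | v ≠ 0}) (affine W) (fun v : {v : V // v ≠ 0} => L v.1) v :=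
  RegAt.linear (V := V) (L.restrictScalars ℝ) (RegAt.id (X := (affine V).sub {v : V | v ≠ 0}) v).val

theorem isOpen_preimage_nonvanishing (L : V →ₗ[K] W) :
    IsOpen[((affine V).sub {v : V | v ≠ 0}).top]
      ((fun v : {v : V // v ≠ 0} => Projectivization.mk K v.1 v.2) ⁻¹' nonvanishing L) := by
  refine isOpen_iff_mem_nhds.2 fun v hv => ?_
  filter_upwards [(regAt_linear_val L v).eventually_ne_zero (mk_mem_nonvanishing.1 hv)] with w hw
  exact mk_mem_nonvanishing.2 hw

theorem isOpen_nonvanishing (L : V →ₗ[K] W) : IsOpen[(projective K V).top] (nonvanishing L) :=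
  isOpen_coinduced.2 (isOpen_preimage_nonvanishing L)

theorem regAt_linRatio (L : V →ₗ[K] W) {m : V →ₗ[K] K} {p : ℙ K V} (hp : p ∈ nonvanishing m) :
    RegAt (projective K V) (affine W) (linRatio L m : ℙ K V → W) p :=
  .of_quotient (isOpen_preimage_nonvanishing m) (fun v hv => by
    simp only [linRatio_mk]
    exact ((regAt_linear_val m v).inv (mk_mem_nonvanishing.1 hv)).smul (regAt_linear_val L v)) hp

end projective

/-! ## Separatedness -/

/-- Any two points are separated by a function that is regular at both of them. -/
def SeparatesPoints (X : RSpace) : Prop :=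
  ∀ x y : X, x ≠ y → ∃ f : X → ℝ, X.Reg f x ∧ X.Reg f y ∧ f x ≠ f y

namespace SeparatesPoints

variable {X Y : RSpace}

theorem isClosed_diagonal (h : X.SeparatesPoints) :
    IsClosed {p : X.prod X | (show X × X from p).1 = (show X × X from p).2} := by
  refine isOpen_compl_iff.1 (isOpen_iff_mem_nhds.2 ?_)
  rintro ⟨x, y⟩ hxy
  obtain ⟨f, hfx, hfy, hne⟩ := h x y hxy
  have hsub := reg_sub ((RegAt.id (X := X.prod X) (x, y)).fst.2 f hfx)
    ((RegAt.id (X := X.prod X) (x, y)).snd.2 f hfy)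
  filter_upwards [(X.prod X).reg_ne_zero hsub (sub_ne_zero.2 hne)] with p hp hdiag
  exact sub_ne_zero.1 hp (congrArg f hdiag)

theorem comap (h : Y.SeparatesPoints) (f : X → Y) (hf : ∀ x, RegAt X Y f x)
    (hi : Function.Injective f) : X.SeparatesPoints := fun x y hxy =>
  let ⟨g, hgx, hgy, hne⟩ := h (f x) (f y) (hi.ne hxy)
  ⟨fun z => g (f z), (hf x).2 g hgx, (hf y).2 g hgy, hne⟩

theorem sub (h : X.SeparatesPoints) (S : Set X) : (X.sub S).SeparatesPoints :=
  h.comap Subtype.val (fun x => (RegAt.id x).val) Subtype.val_injective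

theorem prod (hX : X.SeparatesPoints) (hY : Y.SeparatesPoints) : (X.prod Y).SeparatesPoints := by
  intro (p : X × Y) (q : X × Y) hne
  have hfst : ∀ z : X × Y, RegAt (X.prod Y) X (fun z : X × Y => z.1) z := fun z => (RegAt.id z).fst
  have hsnd : ∀ z : X × Y, RegAt (X.prod Y) Y (fun z : X × Y => z.2) z := fun z => (RegAt.id z).snd
  by_cases h1 : p.1 = q.1
  · obtain ⟨f, hfp, hfq, hf⟩ := hY p.2 q.2 fun h2 => hne (Prod.ext h1 h2)
    exact ⟨fun z : X × Y => f z.2, (hsnd p).2 f hfp, (hsnd q).2 f hfq, hf⟩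
  · obtain ⟨f, hfp, hfq, hf⟩ := hX p.1 q.1 h1
    exact ⟨fun z : X × Y => f z.1, (hfst p).2 f hfp, (hfst q).2 f hfq, hf⟩

theorem affine (V : Type) [AddCommGroup V] [Module ℝ V] : (RSpace.affine V).SeparatesPoints := by
  intro (v : V) (w : V) hne
  obtain ⟨l, hl⟩ : ∃ l : V →ₗ[ℝ] ℝ, l (v - w) ≠ 0 := by
    by_contra! h
    exact hne (sub_eq_zero (a := v).1 ((Module.forall_dual_apply_eq_zero_iff ℝ _).1 h))
  have hreg : ∀ u : V, (RSpace.affine V).Reg l u := fun u => regAt_affine_iff.1 (RegAt.id u) l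
  exact ⟨l, hreg v, hreg w, fun h => hl (by rw [map_sub, h, sub_self])⟩

theorem quotient (h : X.SeparatesPoints) {Y : Type} {φ : X → Y} (hφ : Function.Bijective φ) :
    (X.quotient φ).SeparatesPoints := by
  let e := Equiv.ofBijective φ hφ
  have hreg : ∀ y : Y, RegAt (X.quotient φ) X e.symm y := fun y =>
    .of_quotient (U := Set.univ) isOpen_univ
      (fun x _ => (RegAt.id x).congr (.of_forall fun x' => (e.symm_apply_apply x').symm)) trivial
  exact h.comap (X := X.quotient φ) e.symm hreg e.symm.injective

/-- Two points of a projective space lie in the affine space where a single linear form does not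
vanish. -/
theorem projective (K V : Type) [RCLike K] [AddCommGroup V] [Module K V] [Module ℝ V]
    [IsScalarTower ℝ K V] : (RSpace.projective K V).SeparatesPoints := by
  intro (p : ℙ K V) (q : ℙ K V) hpq
  obtain ⟨m, hm⟩ := Module.exists_dual_forall_apply_ne_zero (K := K) ![p.rep, q.rep]
    (by simp [Fin.forall_fin_two, Projectivization.rep_nonzero])
  have hp : p ∈ nonvanishing m := hm 0
  have hq : q ∈ nonvanishing m := hm 1
  have hne : linRatio LinearMap.id m p ≠ linRatio LinearMap.id m q := fun h => by
    refine hpq (show p = q from ?_)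
    rw [← p.mk_rep, ← q.mk_rep, Projectivization.mk_eq_mk_iff']
    refine ⟨m p.rep * (m q.rep)⁻¹, ?_⟩
    rw [mul_smul, show (m q.rep)⁻¹ • q.rep = (m p.rep)⁻¹ • p.rep from h.symm,
      smul_inv_smul₀ hp]
  obtain ⟨f, hfp, hfq, hf⟩ := SeparatesPoints.affine V _ _ hne
  exact ⟨fun z : ℙ K V => f (linRatio LinearMap.id m z : V),
    (regAt_linRatio LinearMap.id hp).2 f hfp, (regAt_linRatio LinearMap.id hq).2 f hfq, hf⟩

end SeparatesPoints

/-! ## Charts -/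

theorem isSmoothAffine_of_chart {Ω : RSpace} {S U : Set Ω} {n : ℕ} (q : MvPolynomial (Fin n) ℝ)
    {φ : (Fin n → ℝ) → Ω} {ψ : Ω → Fin n → ℝ}
    (hφ : ∀ x, MvPolynomial.eval x q ≠ 0 → RegAt (affine (Fin n → ℝ)) Ω φ x)
    (hψ : ∀ ω ∈ U, RegAt Ω (affine (Fin n → ℝ)) ψ ω)
    (himage : φ '' {x | MvPolynomial.eval x q ≠ 0} = S ∩ U)
    (hinv : Set.LeftInvOn ψ φ {x | MvPolynomial.eval x q ≠ 0}) :
    IsSmoothAffine ((Ω.sub S).sub (Subtype.val ⁻¹' U)) := by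
  have hmaps : ∀ x, MvPolynomial.eval x q ≠ 0 → φ x ∈ S ∩ U := fun x hx =>
    himage ▸ Set.mem_image_of_mem φ hx
  have hrange : ∀ ω ∈ S ∩ U, MvPolynomial.eval (ψ ω) q ≠ 0 ∧ φ (ψ ω) = ω := fun ω hω => by
    obtain ⟨x, hx, rfl⟩ := himage.symm ▸ hω
    rw [hinv hx]
    exact ⟨hx, rfl⟩
  refine ⟨n, 0, Fin.elim0, q, fun x _ => linearIndependent_empty_type, ⟨?_⟩⟩
  let f : (Ω.sub S).sub (Subtype.val ⁻¹' U) → (affine (Fin n → ℝ)).sub (locus Fin.elim0 q) :=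
    fun ω => ⟨ψ ω.1.1, fun i => i.elim0, (hrange _ ⟨ω.1.2, ω.2⟩).1⟩
  let g : (affine (Fin n → ℝ)).sub (locus Fin.elim0 q) → (Ω.sub S).sub (Subtype.val ⁻¹' U) :=
    fun x => ⟨⟨φ x.1, (hmaps _ x.2.2).1⟩, (hmaps _ x.2.2).2⟩
  have hf : ∀ ω, RegAt _ _ f ω := fun ω =>
    .codRestrict (.comp (Y := Ω) (Z := affine (Fin n → ℝ)) (hψ _ ω.2) (RegAt.id ω).val.val)
  have hg : ∀ x, RegAt _ _ g x := fun x =>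
    .codRestrict (.codRestrict (.comp (Y := affine (Fin n → ℝ)) (g := φ) (hφ _ x.2.2)
      (RegAt.id x).val))
  refine ⟨RegAt.hom f hf, RegAt.hom g hg, Hom.ext (funext fun ω => ?_),
    Hom.ext (funext fun x => ?_)⟩
  · exact Subtype.ext (Subtype.ext (hrange _ ⟨ω.1.2, ω.2⟩).2)
  · exact Subtype.ext (hinv x.2.2)

theorem isSmoothVariety_of_charts {Ω : RSpace} {S : Set Ω} (hsep : Ω.SeparatesPoints) {ι : Type}
    [Finite ι] (U : ι → Set Ω) (hU : ∀ i, IsOpen (U i)) (hS : ∀ ω ∈ S, ∃ i, ω ∈ U i)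
    (h : ∀ i, IsSmoothAffine ((Ω.sub S).sub (Subtype.val ⁻¹' U i))) :
    (Ω.sub S).IsSmoothVariety := by
  obtain ⟨m, ⟨e⟩⟩ := Finite.exists_equiv_fin ι
  refine ⟨(hsep.sub S).isClosed_diagonal, m, fun k => Subtype.val ⁻¹' U (e.symm k),
    fun k => (hU _).preimage continuous_subtype_val, fun ω => ?_, fun k => h _⟩
  obtain ⟨i, hi⟩ := hS ω.1 ω.2
  exact ⟨e i, show ω.1 ∈ U (e.symm (e i)) by rwa [e.symm_apply_apply]⟩

end RSpace

/-! ## Fine moduli spaces -/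

theorem isFineModuliSpace_of_representableBy {F : SmoothVarᵒᵖ ⥤ Type} {M : SmoothVar}
    (R : F.RepresentableBy M) : IsFineModuliSpace F M (R.homEquiv (𝟙 M)) := by
  refine ⟨R, rfl, fun B f => ?_, fun E Ψ => ?_⟩
  · simp only [← R.homEquiv_eq]
    exact R.homEquiv.bijective.existsUnique f
  · refine ⟨R.toIso.hom ≫ Ψ, by simp, ?_⟩
    rintro Φ rfl
    simp

/-- Families over `B` with members in `S` are the morphisms from `B` to `S`. -/
def familyRepresentableBy {Ω : RSpace} {S : Set Ω} (h : (Ω.sub S).IsSmoothVariety) :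
    (familyFunctor Ω S).RepresentableBy ⟨Ω.sub S, h⟩ where
  homEquiv :=
    { toFun := fun m => (familyFunctor Ω S).map m.op (tautologicalFamily Ω S h)
      invFun := fun f => ⟨RSpace.RegAt.hom (Y := Ω.sub S)
        (fun b => ⟨RSpace.onPoints f.1 b, f.2 b⟩) fun b =>
        .codRestrict ⟨f.1.continuous_toFun.continuousAt, f.1.reg_comp b⟩⟩
      left_inv := fun _ => rfl
      right_inv := fun _ => rfl }
  homEquiv_comp _ _ := rfl

theorem isFineModuliSpace_tautologicalFamily {Ω : RSpace} {S : Set Ω}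
    (h : (Ω.sub S).IsSmoothVariety) :
    IsFineModuliSpace (familyFunctor Ω S) ⟨Ω.sub S, h⟩ (tautologicalFamily Ω S h) :=
  isFineModuliSpace_of_representableBy (familyRepresentableBy h)

/-! ## Arguments modulo `π` -/

theorem coe_addCircle_pi_eq_of_angle_eq {a b : ℝ} (h : (a : Real.Angle) = b) :
    (a : AddCircle Real.pi) = b := by
  obtain ⟨k, hk⟩ := Real.Angle.angle_eq_iff_two_pi_dvd_sub.1 h
  refine QuotientAddGroup.eq_iff_sub_mem.2 (AddSubgroup.mem_zmultiples_iff.2 ⟨2 * k, ?_⟩)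
  simp only [zsmul_eq_mul, Int.cast_mul, Int.cast_ofNat]
  linarith

theorem argModPi_mul {z w : ℂ} (hz : z ≠ 0) (hw : w ≠ 0) :
    argModPi (z * w) = argModPi z + argModPi w :=
  coe_addCircle_pi_eq_of_angle_eq (b := z.arg + w.arg) (Complex.arg_mul_coe_angle hz hw)

theorem argModPi_div {z w : ℂ} (hz : z ≠ 0) (hw : w ≠ 0) :
    argModPi (z / w) = argModPi z - argModPi w :=
  coe_addCircle_pi_eq_of_angle_eq (b := z.arg - w.arg) (Complex.arg_div_coe_angle hz hw)

theorem argModPi_eq_zero_iff {z : ℂ} : argModPi z = 0 ↔ z.im = 0 := by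
  rw [argModPi, AddCircle.coe_eq_zero_iff]
  simp only [zsmul_eq_mul]
  rw [← Real.sin_eq_zero_iff, Complex.sin_arg, div_eq_zero_iff, norm_eq_zero]
  exact or_iff_left_of_imp fun h => by rw [h, Complex.zero_im]

theorem argModPi_one : argModPi 1 = 0 := argModPi_eq_zero_iff.2 Complex.one_im

theorem argModPi_eq_iff {z w : ℂ} (hz : z ≠ 0) (hw : w ≠ 0) :
    argModPi z = argModPi w ↔ (z / w).im = 0 := by
  rw [← argModPi_eq_zero_iff, argModPi_div hz hw, sub_eq_zero]

theorem exists_argModPi_eq (ξ : AddCircle Real.pi) : ∃ z : ℂ, z ≠ 0 ∧ argModPi z = ξ := by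
  obtain ⟨θ, rfl⟩ := QuotientAddGroup.mk_surjective ξ
  refine ⟨Complex.exp (θ * Complex.I), Complex.exp_ne_zero _, coe_addCircle_pi_eq_of_angle_eq ?_⟩
  rw [Complex.exp_mul_I, ← Complex.ofReal_cos, ← Complex.ofReal_sin]
  simpa only [Real.Angle.cos_coe, Real.Angle.sin_coe] using
    Complex.arg_cos_add_sin_mul_I_coe_angle (θ : Real.Angle)

/-! ## Slopes -/

/-- The coordinate `x` of `z = e * (x + y i)`, for `e ≠ 0`. -/
noncomputable def divRe (e : ℂ) : ℂ →ₗ[ℝ] ℝ := Complex.reLm ∘ₗ LinearMap.mulRight ℝ e⁻¹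

/-- The coordinate `y` of `z = e * (x + y i)`, for `e ≠ 0`. -/
noncomputable def divIm (e : ℂ) : ℂ →ₗ[ℝ] ℝ := Complex.imLm ∘ₗ LinearMap.mulRight ℝ e⁻¹

theorem divRe_apply (e z : ℂ) : divRe e z = (z / e).re := rfl

theorem divIm_apply (e z : ℂ) : divIm e z = (z / e).im := rfl

/-- The vector of slope `m` relative to the direction `e` (so `e` itself has slope `0`, and `e * i`
has slope `∞`) whose component along `e` is `e`. -/
noncomputable def slopeVec (e : ℂ) (m : ℝ) : ℂ := e * (1 + m * Complex.I)

/-- The slope, relative to the direction `e`, of a line through `0` in `ℂ` given by its argument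
modulo `π`. It has the value `0` outside `slopeDomain e`. -/
noncomputable def slope (e : ℂ) (ξ : AddCircle Real.pi) : ℝ :=
  Real.tan_periodic.lift (ξ - argModPi e)

/-- The arguments of the lines that have a finite slope relative to the direction `e`. -/
def slopeDomain (e : ℂ) : Set (AddCircle Real.pi) := {ξ | ξ ≠ argModPi (Complex.I * e)}

section slope

variable {e : ℂ} (he : e ≠ 0)
include he

theorem divRe_slopeVec (m : ℝ) : divRe e (slopeVec e m) = 1 := by
  simp [divRe_apply, slopeVec, he]

theorem divIm_slopeVec (m : ℝ) : divIm e (slopeVec e m) = m := by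
  simp [divIm_apply, slopeVec, he]

theorem slopeVec_ne_zero (m : ℝ) : slopeVec e m ≠ 0 := fun h => by
  simpa [h] using divRe_slopeVec he m

theorem divRe_smul_slopeVec {z : ℂ} (hz : divRe e z ≠ 0) :
    divRe e z • slopeVec e (divIm e z / divRe e z) = z := by
  refine (div_left_inj' he).1 (Complex.ext ?_ ?_)
  · rw [← divRe_apply, map_smul, divRe_slopeVec he, smul_eq_mul, mul_one, divRe_apply]
  · rw [← divIm_apply, map_smul, divIm_slopeVec he, smul_eq_mul, mul_div_cancel₀ _ hz, divIm_apply]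

theorem argModPi_mem_slopeDomain {z : ℂ} (hz : z ≠ 0) :
    argModPi z ∈ slopeDomain e ↔ divRe e z ≠ 0 := by
  have him : (z / (Complex.I * e)).im = -divRe e z := by
    rw [mul_comm, ← div_div, Complex.div_I, divRe_apply]
    simp
  rw [slopeDomain, Set.mem_ofPred_eq, Ne, argModPi_eq_iff hz (mul_ne_zero Complex.I_ne_zero he),
    him, neg_eq_zero]

theorem slope_argModPi {z : ℂ} (hz : z ≠ 0) : slope e (argModPi z) = divIm e z / divRe e z := by
  rw [slope, ← argModPi_div hz he]
  exact Complex.tan_arg _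

theorem argModPi_slopeVec_mem_slopeDomain (m : ℝ) : argModPi (slopeVec e m) ∈ slopeDomain e := by
  simp [argModPi_mem_slopeDomain he (slopeVec_ne_zero he m), divRe_slopeVec he]

theorem slope_argModPi_slopeVec (m : ℝ) : slope e (argModPi (slopeVec e m)) = m := by
  rw [slope_argModPi he (slopeVec_ne_zero he m), divRe_slopeVec he, divIm_slopeVec he, div_one]

theorem argModPi_slopeVec_slope {ξ : AddCircle Real.pi} (hξ : ξ ∈ slopeDomain e) :
    argModPi (slopeVec e (slope e ξ)) = ξ := by
  obtain ⟨z, hz, rfl⟩ := exists_argModPi_eq ξ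
  have hre := (argModPi_mem_slopeDomain he hz).1 hξ
  rw [slope_argModPi he hz]
  conv_rhs => rw [← divRe_smul_slopeVec he hre, ← Complex.coe_smul, smul_eq_mul,
    argModPi_real_mul _ hre]

end slope

/-- Relative to one of these two directions, a given line has a finite slope. -/
abbrev axes : Set ℂ := {1, Complex.I}

/-- The direction of the real axis. -/
def realAxis : axes := ⟨1, .inl rfl⟩

theorem slopeVec_realAxis_zero : slopeVec realAxis 0 = 1 := by
  simp [slopeVec, realAxis]

theorem axis_ne_zero (e : axes) : (e : ℂ) ≠ 0 := by
  rcases e with ⟨e, rfl | rfl⟩ <;> simp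

theorem exists_axis_divRe_ne_zero {z : ℂ} (hz : z ≠ 0) : ∃ e : axes, divRe e z ≠ 0 := by
  by_contra! h
  refine hz (Complex.ext ?_ ?_)
  · simpa [divRe_apply] using h ⟨1, .inl rfl⟩
  · simpa [divRe_apply] using h ⟨Complex.I, .inr rfl⟩

theorem exists_axis_mem_slopeDomain (ξ : AddCircle Real.pi) : ∃ e : axes, ξ ∈ slopeDomain e := by
  obtain ⟨z, hz, rfl⟩ := exists_argModPi_eq ξ
  obtain ⟨e, he⟩ := exists_axis_divRe_ne_zero hz
  exact ⟨e, (argModPi_mem_slopeDomain (axis_ne_zero e) hz).2 he⟩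

/-! ## The circle `ℝ/π` as a variety -/

/-- The identification `(x, y) ↦ x + y i` of `ℝ²` with `ℂ`. -/
noncomputable def vecToComplex : (Fin 2 → ℝ) ≃ₗ[ℝ] ℂ := Complex.basisOneI.equivFun.symm

theorem rho_mk {v : Fin 2 → ℝ} (hv : v ≠ 0) :
    rho (Projectivization.mk ℝ v hv) = argModPi (vecToComplex v) := by
  have h : vecToComplex v = ⟨v 0, v 1⟩ := by
    apply Complex.ext <;> simp [vecToComplex, Module.Basis.equivFun_symm_apply]
  rw [h]
  rfl

theorem rho_bijective : Function.Bijective rho := by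
  refine ⟨fun p q h => ?_, fun ξ => ?_⟩
  · induction p with | h v hv =>
    induction q with | h w hw =>
    have hv' := vecToComplex.map_ne_zero_iff.2 hv
    have hw' := vecToComplex.map_ne_zero_iff.2 hw
    rw [rho_mk, rho_mk, argModPi_eq_iff hv' hw'] at h
    refine (Projectivization.mk_eq_mk_iff' ..).2
      ⟨(vecToComplex v / vecToComplex w).re, vecToComplex.injective ?_⟩
    rw [map_smul, Complex.real_smul, ← eq_div_iff hw']
    exact Complex.ext (by simp) (by simp [h])
  · obtain ⟨z, hz, rfl⟩ := exists_argModPi_eq ξ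
    exact ⟨.mk ℝ (vecToComplex.symm z) (vecToComplex.symm.map_ne_zero_iff.2 hz), by simp [rho_mk]⟩

theorem circle_separatesPoints : circle.SeparatesPoints :=
  (RSpace.SeparatesPoints.projective ℝ (Fin 2 → ℝ)).quotient rho_bijective

theorem rho_preimage_slopeDomain {e : ℂ} (he : e ≠ 0) :
    rho ⁻¹' slopeDomain e = RSpace.nonvanishing (divRe e ∘ₗ vecToComplex.toLinearMap) := by
  ext p
  induction p with | h v hv =>
  rw [Set.mem_preimage, rho_mk, RSpace.mk_mem_nonvanishing,
    argModPi_mem_slopeDomain he (vecToComplex.map_ne_zero_iff.2 hv)]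
  rfl

theorem slope_rho {e : ℂ} (he : e ≠ 0) (p : ℙ ℝ (Fin 2 → ℝ)) :
    slope e (rho p) = RSpace.linRatio (divIm e ∘ₗ vecToComplex.toLinearMap)
      (divRe e ∘ₗ vecToComplex.toLinearMap) p := by
  induction p with | h v hv =>
  rw [rho_mk, RSpace.linRatio_mk, slope_argModPi he (vecToComplex.map_ne_zero_iff.2 hv),
    div_eq_inv_mul]
  rfl

theorem isOpen_rho_preimage_slopeDomain {e : ℂ} (he : e ≠ 0) :
    IsOpen[(RSpace.projective ℝ (Fin 2 → ℝ)).top] (rho ⁻¹' slopeDomain e) :=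
  rho_preimage_slopeDomain he ▸ RSpace.isOpen_nonvanishing _

theorem isOpen_slopeDomain {e : ℂ} (he : e ≠ 0) : IsOpen[circle.top] (slopeDomain e) :=
  isOpen_coinduced.2 (isOpen_rho_preimage_slopeDomain he)

open RSpace in
theorem circle_reg_slope {e : ℂ} (he : e ≠ 0) {ξ : AddCircle Real.pi} (hξ : ξ ∈ slopeDomain e) :
    circle.Reg (slope e) ξ := by
  refine regAt_real_iff.1 (.of_quotient (isOpen_rho_preimage_slopeDomain he) (fun p hp => ?_) hξ)
  have hp' : p ∈ nonvanishing _ :=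
    rho_preimage_slopeDomain he ▸ (show p ∈ rho ⁻¹' slopeDomain e from hp)
  exact (regAt_linRatio _ hp').congr (.of_forall fun p' => (slope_rho he p').symm)

namespace RSpace.RegAt

variable {X : RSpace} {x : X}

theorem slopeVec {f : X → ℝ} (hf : X.Reg f x) (e : ℂ) :
    RegAt X (affine ℂ) (fun y => TriangleModuli.slopeVec e (f y)) x := by
  have hrw : ∀ m : ℝ, TriangleModuli.slopeVec e m = e + m • (e * Complex.I) := fun m => by
    rw [TriangleModuli.slopeVec, Complex.real_smul]
    ring
  simpa only [hrw] using (const e x).add ((regAt_real_iff.2 hf).smul (const _ x))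

theorem argModPi {f : X → ℂ} (hf : RegAt X (affine ℂ) f x) (h0 : f x ≠ 0) :
    RegAt X circle (fun y => TriangleModuli.argModPi (f y)) x := by
  classical
  let g : X → ℂ := fun y => if f y = 0 then 1 else f y
  have hg0 : ∀ y, g y ≠ 0 := fun y => by
    by_cases h : f y = 0 <;> simp [g, h]
  have hgf : ∀ᶠ y in 𝓝 x, g y = f y :=
    (hf.eventually_ne_zero h0).mono fun y hy => if_neg hy
  have hg : RegAt X (affine ℂ) g x := hf.congr (hgf.mono fun _ => Eq.symm)
  have hmk := (hg.linear vecToComplex.symm.toLinearMap).projectivizationMk (K := ℝ)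
    fun y => vecToComplex.symm.map_ne_zero_iff.2 (hg0 y)
  refine ((quotientMap rho _).comp hmk).congr (hgf.mono fun y hy => ?_)
  rw [← hy]
  exact (rho_mk _).trans (by simp)

theorem argModPi_sub_argModPi {f g : X → ℂ} (hf : RegAt X (affine ℂ) f x)
    (hg : RegAt X (affine ℂ) g x) (hf0 : f x ≠ 0) (hg0 : g x ≠ 0) :
    RegAt X circle (fun y => TriangleModuli.argModPi (f y) - TriangleModuli.argModPi (g y)) x := by
  refine ((hf.mul (hg.inv hg0)).argModPi (mul_ne_zero hf0 (inv_ne_zero hg0))).congr ?_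
  filter_upwards [hf.eventually_ne_zero hf0, hg.eventually_ne_zero hg0] with y hfy hgy
  exact argModPi_div hfy hgy

end RSpace.RegAt

/-! ## Triples -/

/-- Families indexed by `Fin 3` as triples, the form in which the angles are given. -/
def tripleEquiv {M : Type*} : (Fin 3 → M) ≃ M × M × M where
  toFun f := (f 0, f 1, f 2)
  invFun p := ![p.1, p.2.1, p.2.2]
  left_inv f := by funext l; fin_cases l <;> rfl
  right_inv _ := rfl

theorem forall_fin_three_iff (i : Fin 3) {P : Fin 3 → Prop} :
    (∀ l, P l) ↔ P i ∧ P (i + 1) ∧ P (i + 2) := by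
  rw [← (Equiv.addLeft i).forall_congr_right, Fin.forall_fin_succ, Fin.forall_fin_two]
  simp only [Equiv.coe_addLeft, add_zero]
  rfl

theorem sum_fin_three {M : Type*} [AddCommMonoid M] (f : Fin 3 → M) (i : Fin 3) :
    f i + f (i + 1) + f (i + 2) = f 0 + f 1 + f 2 := by
  rw [← Fin.sum_univ_three, ← Fintype.sum_equiv (Equiv.addLeft i) _ f fun _ => rfl,
    Fin.sum_univ_three]
  simp only [Equiv.coe_addLeft, add_zero]

/-- The triple with entries `a, b, c` in positions `i, i + 1, i + 2`. -/
def cyc {M : Type*} (i : Fin 3) (a b c : M) (l : Fin 3) : M := ![a, b, c] (l - i)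

section cyc

variable {M : Type*} (i : Fin 3) (a b c : M)

@[simp] theorem cyc_zero : cyc i a b c i = a := by simp [cyc]

@[simp] theorem cyc_one : cyc i a b c (i + 1) = b := by simp [cyc]

@[simp] theorem cyc_two : cyc i a b c (i + 2) = c := by simp [cyc]

end cyc

theorem sum_cyc {M : Type*} [AddCommMonoid M] (i : Fin 3) (a b c : M) :
    cyc i a b c 0 + cyc i a b c 1 + cyc i a b c 2 = a + b + c := by
  simp [← sum_fin_three _ i]

theorem RSpace.RegAt.cyc {X Y : RSpace} {f g h : X → Y} {x : X} (hf : RegAt X Y f x)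
    (hg : RegAt X Y g x) (hh : RegAt X Y h x) (i l : Fin 3) :
    RegAt X Y (fun y => TriangleModuli.cyc i (f y) (g y) (h y) l) x := by
  revert l
  simpa [forall_fin_three_iff i] using ⟨hf, hg, hh⟩

theorem RSpace.RegAt.tripleEquiv {X : RSpace} {f : X → Fin 3 → AddCircle Real.pi} {x : X}
    (hf : ∀ l, RegAt X circle (fun y => f y l) x) :
    RegAt X circle3 (fun y => TriangleModuli.tripleEquiv (f y)) x :=
  (hf 0).prodMk ((hf 1).prodMk (hf 2))

theorem regAt_tripleEquiv_symm (l : Fin 3) (ξ : circle3) :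
    RSpace.RegAt circle3 circle (fun ξ => tripleEquiv.symm ξ l) ξ := by
  have hid := RSpace.RegAt.id (X := circle3) ξ
  fin_cases l
  exacts [hid.fst, hid.snd.fst, hid.snd.snd]

theorem circle3_separatesPoints : circle3.SeparatesPoints :=
  circle_separatesPoints.prod (circle_separatesPoints.prod circle_separatesPoints)

/-! ## Side vectors and their arguments -/

/-- The nonzero triples of side vectors. -/
abbrev NonzeroSides : Type := {w : Fin 3 → ℂ // w ≠ 0 ∧ w 0 + w 1 + w 2 = 0}

theorem NonzeroSides.exists_two_ne_zero (w : NonzeroSides) :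
    ∃ i : Fin 3, w.1 (i + 1) ≠ 0 ∧ w.1 (i + 2) ≠ 0 := by
  obtain ⟨w, hw, hsum⟩ := w
  obtain ⟨j, hj⟩ := Function.ne_iff.1 hw
  rw [← sum_fin_three w j] at hsum
  by_cases h1 : w (j + 1) = 0
  · refine ⟨j + 1, fun h2 => hj ?_, ?_⟩
    · simpa [h1, show w (j + 2) = 0 by simpa [add_assoc, one_add_one_eq_two] using h2] using hsum
    · simpa [add_assoc, show (1 + 2 : Fin 3) = 0 from rfl] using hj
  · refine ⟨j + 2, ?_, ?_⟩
    · simpa [add_assoc, show (2 + 1 : Fin 3) = 0 from rfl] using hj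
    · simpa [add_assoc, show (2 + 2 : Fin 3) = 1 from rfl] using h1

/-- `η` are arguments modulo `π` of the components of `w`, where that of a zero component is
arbitrary. -/
def IsArgOf (w : Fin 3 → ℂ) (η : Fin 3 → AddCircle Real.pi) : Prop :=
  ∀ l, w l ≠ 0 → η l = argModPi (w l)

theorem IsArgOf.smul {w : Fin 3 → ℂ} {η : Fin 3 → AddCircle Real.pi} (h : IsArgOf w η) {c : ℂ}
    (hc : c ≠ 0) : IsArgOf (c • w) (fun l => argModPi c + η l) := fun l hl => by
  have hwl : w l ≠ 0 := right_ne_zero_of_mul hl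
  simpa only [h l hwl, Pi.smul_apply, smul_eq_mul] using (argModPi_mul hc hwl).symm

/-- The identification of `ℝ⁶` with `ℂ³`. -/
noncomputable def coordsEquiv : (Fin 6 → ℝ) ≃ₗ[ℝ] (Fin 3 → ℂ) where
  toFun := complexCoords
  invFun := realCoords
  map_add' v w := by funext l; fin_cases l <;> apply Complex.ext <;> simp [complexCoords]
  map_smul' t v := by funext l; fin_cases l <;> apply Complex.ext <;> simp [complexCoords]
  left_inv v := by funext l; fin_cases l <;> rfl
  right_inv w := by funext l; fin_cases l <;> rfl

/-! ## Normal forms of triangles -/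

/-- The side following a side of direction `slopeVec e m` and signed length `r`, and the side
`slopeVec e' m'`. -/
noncomputable def thirdSide (e e' : ℂ) (r m m' : ℝ) : ℂ := -(r • slopeVec e m) - slopeVec e' m'

/-- `(a, b, c) = (r u, v, -r u - v)`, up to a cyclic permutation by `i`, where `u` and `v` have
slopes `m` and `m'`. Only the side `a` is allowed to vanish. -/
noncomputable def normalSides (i : Fin 3) (e e' : axes) (r m m' : ℝ) : NonzeroSides :=
  ⟨cyc i (r • slopeVec e m) (slopeVec e' m') (thirdSide e e' r m m'),
    fun h => slopeVec_ne_zero (axis_ne_zero e') m' (by simpa using congrFun h (i + 1)),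
    by rw [sum_cyc, thirdSide]; ring⟩

/-- Vectors in the directions of the sides `normalSides`, including the one of length `r` when
`r = 0`. -/
noncomputable def normalDirs (i : Fin 3) (e e' : axes) (r m m' : ℝ) : Fin 3 → ℂ :=
  cyc i (slopeVec e m) (slopeVec e' m') (thirdSide e e' r m m')

/-- The squared length of `thirdSide` as a polynomial. -/
noncomputable def thirdSidePoly {σ : Type*} (e e' : ℂ) (r m m' : MvPolynomial σ ℝ) :
    MvPolynomial σ ℝ :=
  (r * (.C e.re - .C e.im * m) + (.C e'.re - .C e'.im * m')) ^ 2 +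
    (r * (.C e.im + .C e.re * m) + (.C e'.im + .C e'.re * m')) ^ 2

theorem eval_thirdSidePoly_ne_zero_iff {σ : Type*} {e e' : ℂ} {r m m' : MvPolynomial σ ℝ}
    {x : σ → ℝ} :
    MvPolynomial.eval x (thirdSidePoly e e' r m m') ≠ 0 ↔
      thirdSide e e' (MvPolynomial.eval x r) (MvPolynomial.eval x m)
        (MvPolynomial.eval x m') ≠ 0 := by
  rw [Ne, Ne, ← Complex.normSq_eq_zero (z := thirdSide ..), Complex.normSq_apply]
  simp [thirdSidePoly, thirdSide, slopeVec]
  ring_nf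

section normalForm

variable {i : Fin 3} {e e' : axes}

theorem isArgOf_normalSides (r m m' : ℝ) :
    IsArgOf (normalSides i e e' r m m').1 fun l => argModPi (normalDirs i e e' r m m' l) := by
  refine (forall_fin_three_iff i).2 ⟨fun h => ?_, fun _ => ?_, fun _ => ?_⟩
  · simp only [normalSides, normalDirs, cyc_zero] at h ⊢
    rw [← Complex.coe_smul, smul_eq_mul, argModPi_real_mul r (left_ne_zero_of_smul h)]
  · simp only [normalSides, normalDirs, cyc_one]
  · simp only [normalSides, normalDirs, cyc_two]

theorem normalDirs_ne_zero {r m m' : ℝ} (h : thirdSide e e' r m m' ≠ 0) (l : Fin 3) :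
    normalDirs i e e' r m m' l ≠ 0 := by
  revert l
  simp [forall_fin_three_iff i, normalDirs, slopeVec_ne_zero (axis_ne_zero _), h]

/-- The argument of the side `i` pins down its slope even where the side vanishes. -/
theorem exists_eq_smul_normalSides {w : NonzeroSides} {η : Fin 3 → AddCircle Real.pi}
    (hη : IsArgOf w.1 η) (h0 : η i ∈ slopeDomain e) (h1 : divRe e' (w.1 (i + 1)) ≠ 0) :
    ∃ ρ r m' : ℝ, ρ ≠ 0 ∧ w.1 = ρ • (normalSides i e e' r (slope e (η i)) m').1 := by
  set ρ := divRe e' (w.1 (i + 1)) with hρ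
  have hside0 : w.1 i = divRe e (w.1 i) • slopeVec e (slope e (η i)) := by
    by_cases hw : w.1 i = 0
    · simp [hw]
    · have hre := (argModPi_mem_slopeDomain (axis_ne_zero e) hw).1 (hη i hw ▸ h0)
      rw [hη i hw, slope_argModPi (axis_ne_zero e) hw, divRe_smul_slopeVec (axis_ne_zero e) hre]
  have hside1 : w.1 (i + 1) = ρ • slopeVec e' (ρ⁻¹ * divIm e' (w.1 (i + 1))) := by
    rw [inv_mul_eq_div, hρ, divRe_smul_slopeVec (axis_ne_zero e') h1]
  have hside2 : w.1 (i + 2) = -w.1 i - w.1 (i + 1) := by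
    linear_combination (sum_fin_three w.1 i).trans w.2.2
  refine ⟨ρ, ρ⁻¹ * divRe e (w.1 i), ρ⁻¹ * divIm e' (w.1 (i + 1)), h1,
    funext ((forall_fin_three_iff i).2 ?_)⟩
  simp only [normalSides, Pi.smul_apply, cyc_zero, cyc_one, cyc_two, thirdSide, smul_sub, smul_neg,
    smul_smul, mul_inv_cancel_left₀ h1, ← hside0, ← hside1]
  exact ⟨trivial, trivial, hside2⟩

theorem IsArgOf.exists_eq_normalSides {w : NonzeroSides} {η : Fin 3 → AddCircle Real.pi}
    (hη : IsArgOf w.1 η) (h0 : η i ∈ slopeDomain e) (h1 : divRe e' (w.1 (i + 1)) ≠ 0)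
    (h2 : w.1 (i + 2) ≠ 0) :
    ∃ ρ r m m' : ℝ, thirdSide e e' r m m' ≠ 0 ∧ w.1 = ρ • (normalSides i e e' r m m').1 ∧
      η = fun l => argModPi (normalDirs i e e' r m m' l) := by
  obtain ⟨ρ, r, m', hρ, hw⟩ := exists_eq_smul_normalSides hη h0 h1
  have hw1 : w.1 (i + 1) = ρ * slopeVec e' m' := by simp [hw, normalSides]
  have hw2 : w.1 (i + 2) = ρ * thirdSide e e' r (slope e (η i)) m' := by simp [hw, normalSides]
  refine ⟨ρ, r, _, m', right_ne_zero_of_mul (hw2 ▸ h2), hw,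
    funext ((forall_fin_three_iff i).2 ⟨?_, ?_, ?_⟩)⟩
  · rw [normalDirs, cyc_zero, argModPi_slopeVec_slope (axis_ne_zero e) h0]
  · rw [hη _ fun h => h1 (by rw [h, map_zero]), normalDirs, cyc_one, hw1, argModPi_real_mul ρ hρ]
  · rw [hη _ h2, normalDirs, cyc_two, hw2, argModPi_real_mul ρ hρ]

end normalForm

namespace RSpace.RegAt

variable {X : RSpace} {x : X} {r m m' : X → ℝ}

theorem normalSides (hr : X.Reg r x) (hm : X.Reg m x) (hm' : X.Reg m' x) (i : Fin 3)
    (e e' : axes) :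
    RegAt X (affine (Fin 3 → ℂ))
      (fun y => (TriangleModuli.normalSides i e e' (r y) (m y) (m' y)).1) x := by
  have hu := (regAt_real_iff.2 hr).smul (RegAt.slopeVec hm e)
  have hv := RegAt.slopeVec hm' e'
  exact regAt_pi_iff.2 fun l => hu.cyc hv (hu.neg.sub hv) i l

theorem normalDirs (hr : X.Reg r x) (hm : X.Reg m x) (hm' : X.Reg m' x) (i : Fin 3)
    (e e' : axes) (l : Fin 3) :
    RegAt X (affine ℂ) (fun y => TriangleModuli.normalDirs i e e' (r y) (m y) (m' y) l) x := by
  have hu := RegAt.slopeVec hm e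
  have hv := RegAt.slopeVec hm' e'
  exact hu.cyc hv (((regAt_real_iff.2 hr).smul hu).neg.sub hv) i l

end RSpace.RegAt

/-! ## The variety of triangles -/

/-- The points of the ambient space of the triangles. -/
abbrev TrianglePoint : Type :=
  ℂ × SideVectors × ℙ ℝ (Fin 6 → ℝ) × AddCircle Real.pi × AddCircle Real.pi × AddCircle Real.pi

/-- The triangle with basepoint `B`, shape `w`, arguments `η` of the sides and side vectors `t w`,
where `t = 0` is allowed. -/
noncomputable def mkTriangle (B : ℂ) (t : ℝ) (w : NonzeroSides) (η : Fin 3 → AddCircle Real.pi) :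
    TrianglePoint :=
  (B, ⟨t • w.1, by simp only [Pi.smul_apply, ← smul_add, w.2.2, smul_zero]⟩,
    .mk ℝ (coordsEquiv.symm w.1) (coordsEquiv.symm.map_ne_zero_iff.2 w.2.1), tripleEquiv η)

theorem mkTriangle_eq_of_smul {w w' : NonzeroSides} {ρ : ℝ} (h : w.1 = ρ • w'.1) (B : ℂ) (t : ℝ)
    (η : Fin 3 → AddCircle Real.pi) : mkTriangle B t w η = mkTriangle B (t * ρ) w' η := by
  have hshape := (Projectivization.mk_eq_mk_iff' ℝ _ _
    (coordsEquiv.symm.map_ne_zero_iff.2 w.2.1) (coordsEquiv.symm.map_ne_zero_iff.2 w'.2.1)).2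
    ⟨ρ, by rw [h, map_smul]⟩
  simp only [mkTriangle, hshape]
  simp only [h, smul_smul]

theorem exists_eq_mkTriangle {T : TrianglePoint} (hT : T ∈ triangles) :
    ∃ B t w η, IsArgOf w.1 η ∧ T = mkTriangle B t w η := by
  obtain ⟨B, ⟨s, hs⟩, p, ξ⟩ := T
  obtain ⟨hp, v, hv, rfl, hsum, hξ⟩ := hT
  obtain ⟨t, rfl, hv0⟩ : ∃ t : ℝ, s = t • coordsEquiv v ∧
      coordsEquiv v 0 + coordsEquiv v 1 + coordsEquiv v 2 = 0 := by
    by_cases h0 : s = 0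
    · obtain ⟨hre, him⟩ := hsum h0
      exact ⟨0, by simpa using h0, Complex.ext hre him⟩
    · obtain ⟨h, hmk⟩ := hp h0
      obtain ⟨t, ht⟩ := (Projectivization.mk_eq_mk_iff' ℝ _ _ h hv).1 hmk.symm
      have hst : s = t • coordsEquiv v := by
        rw [← map_smul, ht]
        exact (coordsEquiv.apply_symm_apply s).symm
      have ht0 : t ≠ 0 := left_ne_zero_of_smul (hst ▸ h0)
      refine ⟨t, hst, (smul_eq_zero_iff_right ht0).1 ?_⟩
      rw [smul_add, smul_add]
      rwa [hst] at hs
  refine ⟨B, t, ⟨coordsEquiv v, coordsEquiv.map_ne_zero_iff.2 hv, hv0⟩, tripleEquiv.symm ξ, ?_, ?_⟩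
  · exact Fin.forall_fin_succ.2 ⟨hξ.1, Fin.forall_fin_two.2 hξ.2⟩
  · simp only [mkTriangle, LinearEquiv.symm_apply_apply, Equiv.apply_symm_apply]

theorem mkTriangle_mem_triangles {w : NonzeroSides} {η : Fin 3 → AddCircle Real.pi}
    (hη : IsArgOf w.1 η) (B : ℂ) (t : ℝ) : mkTriangle B t w η ∈ triangles := by
  have hw := coordsEquiv.symm.map_ne_zero_iff.2 w.2.1
  refine ⟨fun h0 => ?_, coordsEquiv.symm w.1, hw, rfl,
    fun _ => ⟨congrArg Complex.re w.2.2, congrArg Complex.im w.2.2⟩, hη 0, hη 1, hη 2⟩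
  refine ⟨coordsEquiv.symm.map_ne_zero_iff.2 h0,
    (Projectivization.mk_eq_mk_iff' ℝ _ _ hw _).2 ⟨t⁻¹, ?_⟩⟩
  exact (congrArg _ (map_smul coordsEquiv.symm t w.1)).trans
    (inv_smul_smul₀ (left_ne_zero_of_smul h0) _)

theorem RSpace.RegAt.mkTriangle {X : RSpace} {x : X} {B : X → ℂ} {t : X → ℝ}
    {w : X → NonzeroSides} {η : X → Fin 3 → AddCircle Real.pi} (hB : RegAt X (affine ℂ) B x)
    (ht : X.Reg t x) (hw : RegAt X (affine (Fin 3 → ℂ)) (fun y => (w y).1) x)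
    (hη : ∀ l, RegAt X circle (fun y => η y l) x) :
    RegAt X triangleAmbient (fun y => TriangleModuli.mkTriangle (B y) (t y) (w y) (η y)) x := by
  have hs : RegAt X sideVectors
      (fun y => (TriangleModuli.mkTriangle (B y) (t y) (w y) (η y)).2.1) x :=
    .codRestrict ((regAt_real_iff.2 ht).smul hw)
  exact hB.prodMk (hs.prodMk (((hw.linear coordsEquiv.symm.toLinearMap).projectivizationMk
    fun y => coordsEquiv.symm.map_ne_zero_iff.2 (w y).2.1).prodMk (.tripleEquiv hη)))

theorem triangleAmbient_separatesPoints : triangleAmbient.SeparatesPoints :=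
  (RSpace.SeparatesPoints.affine ℂ).prod (((RSpace.SeparatesPoints.affine (Fin 3 → ℂ)).sub _).prod
    ((RSpace.SeparatesPoints.projective ℝ (Fin 6 → ℝ)).prod circle3_separatesPoints))

/-- The component `l` of a shape. -/
noncomputable def shapeSide (l : Fin 3) : (Fin 6 → ℝ) →ₗ[ℝ] ℂ :=
  LinearMap.proj l ∘ₗ coordsEquiv.toLinearMap

@[simp]
theorem shapeSide_coordsEquiv_symm (l : Fin 3) (w : Fin 3 → ℂ) :
    shapeSide l (coordsEquiv.symm w) = w l := by
  simp [shapeSide]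

/-- The triangle with coordinates `x`. -/
noncomputable def triangleChart (i : Fin 3) (e e' : axes) (x : Fin 6 → ℝ) : TrianglePoint :=
  mkTriangle ⟨x 0, x 1⟩ (x 2) (normalSides i e e' (x 3) (x 4) (x 5))
    fun l => argModPi (normalDirs i e e' (x 3) (x 4) (x 5) l)

/-- The domain of the coordinates `triangleCoords`: the sides `i + 1` and `i + 2` of the shape do
not vanish, and the sides `i` and `i + 1` have finite slopes relative to `e` and `e'`. -/
def triangleDomain (i : Fin 3) (e e' : axes) : Set TrianglePoint :=
  {T | T.2.2.1 ∈ RSpace.nonvanishing (divRe e' ∘ₗ shapeSide (i + 1)) ∧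
    T.2.2.1 ∈ RSpace.nonvanishing (shapeSide (i + 2)) ∧
    tripleEquiv.symm T.2.2.2 i ∈ slopeDomain e}

/-- The inverse of `triangleChart` on `triangleDomain`. -/
noncomputable def triangleCoords (i : Fin 3) (e e' : axes) (T : TrianglePoint) : Fin 6 → ℝ :=
  ![T.1.re, T.1.im, divRe e' (T.2.1.1 (i + 1)),
    RSpace.linRatio (divRe e ∘ₗ shapeSide i) (divRe e' ∘ₗ shapeSide (i + 1)) T.2.2.1,
    slope e (tripleEquiv.symm T.2.2.2 i),
    RSpace.linRatio (divIm e' ∘ₗ shapeSide (i + 1)) (divRe e' ∘ₗ shapeSide (i + 1)) T.2.2.1]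

section triangleChart

variable {i : Fin 3} {e e' : axes}

theorem mkTriangle_mem_triangleDomain {B : ℂ} {t : ℝ} {w : NonzeroSides}
    {η : Fin 3 → AddCircle Real.pi} : mkTriangle B t w η ∈ triangleDomain i e e' ↔
      divRe e' (w.1 (i + 1)) ≠ 0 ∧ w.1 (i + 2) ≠ 0 ∧ η i ∈ slopeDomain e := by
  simp [mkTriangle, triangleDomain, RSpace.mk_mem_nonvanishing]

theorem triangleCoords_triangleChart (x : Fin 6 → ℝ) :
    triangleCoords i e e' (triangleChart i e e' x) = x := by
  have he := axis_ne_zero e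
  have he' := axis_ne_zero e'
  funext k
  fin_cases k <;> simp [triangleCoords, triangleChart, mkTriangle, RSpace.linRatio_mk, normalSides,
    normalDirs, divRe_slopeVec, divIm_slopeVec, slope_argModPi_slopeVec, he, he',
    -Complex.real_smul]

theorem triangleChart_image :
    triangleChart i e e' ''
        {x | MvPolynomial.eval x (thirdSidePoly e e' (.X 3) (.X 4) (.X 5)) ≠ 0} =
      triangles ∩ triangleDomain i e e' := by
  simp only [eval_thirdSidePoly_ne_zero_iff, MvPolynomial.eval_X]
  refine Set.Subset.antisymm ?_ ?_
  · rintro _ ⟨x, hx, rfl⟩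
    refine ⟨mkTriangle_mem_triangles (isArgOf_normalSides _ _ _) _ _,
      mkTriangle_mem_triangleDomain.2 ⟨?_, ?_, ?_⟩⟩
    · simp [normalSides, divRe_slopeVec (axis_ne_zero e')]
    · simpa [normalSides] using hx
    · simpa [normalDirs] using argModPi_slopeVec_mem_slopeDomain (axis_ne_zero e) (x 4)
  · rintro T ⟨hT, hU⟩
    obtain ⟨B, t, w, η, hη, rfl⟩ := exists_eq_mkTriangle hT
    obtain ⟨h1, h2, h0⟩ := mkTriangle_mem_triangleDomain.1 hU
    obtain ⟨ρ, r, m, m', hne, hw, hηm⟩ := hη.exists_eq_normalSides h0 h1 h2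
    exact ⟨![B.re, B.im, t * ρ, r, m, m'], hne, by rw [mkTriangle_eq_of_smul hw, hηm]; rfl⟩

theorem exists_mem_triangleDomain {T : TrianglePoint} (hT : T ∈ triangles) :
    ∃ i e e', T ∈ triangleDomain i e e' := by
  obtain ⟨B, t, w, η, -, rfl⟩ := exists_eq_mkTriangle hT
  obtain ⟨i, h1, h2⟩ := w.exists_two_ne_zero
  obtain ⟨e, he⟩ := exists_axis_mem_slopeDomain (η i)
  obtain ⟨e', he'⟩ := exists_axis_divRe_ne_zero h1
  exact ⟨i, e, e', mkTriangle_mem_triangleDomain.2 ⟨he', h2, he⟩⟩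

theorem regAt_triangleChart {x : Fin 6 → ℝ} (hx : thirdSide e e' (x 3) (x 4) (x 5) ≠ 0) :
    RSpace.RegAt (.affine (Fin 6 → ℝ)) triangleAmbient (triangleChart i e e') x := by
  have hcoord : ∀ k, (RSpace.affine (Fin 6 → ℝ)).Reg (fun y : Fin 6 → ℝ => y k) x := fun k =>
    RSpace.regAt_real_iff.1 (RSpace.regAt_pi_iff.1 (.id x) k)
  have hsmul : ∀ (k : Fin 6) (v : ℂ), RSpace.RegAt (.affine (Fin 6 → ℝ)) (.affine ℂ)
      (fun y : Fin 6 → ℝ => y k • v) x := fun k v =>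
    (RSpace.regAt_real_iff.2 (hcoord k)).smul (RSpace.RegAt.const (X := .affine _) v x)
  have hB : RSpace.RegAt (.affine (Fin 6 → ℝ)) (.affine ℂ)
      (fun y : Fin 6 → ℝ => (⟨y 0, y 1⟩ : ℂ)) x :=
    ((hsmul 0 1).add (hsmul 1 Complex.I)).congr
      (.of_forall fun y => Complex.ext (by simp) (by simp))
  exact .mkTriangle hB (hcoord 2) (.normalSides (hcoord 3) (hcoord 4) (hcoord 5) i e e') fun l =>
    (RSpace.RegAt.normalDirs (hcoord 3) (hcoord 4) (hcoord 5) i e e' l).argModPi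
      (normalDirs_ne_zero hx l)

theorem regAt_shape (T : TrianglePoint) : RSpace.RegAt triangleAmbient
    (.projective ℝ (Fin 6 → ℝ)) (fun T : TrianglePoint => T.2.2.1) T :=
  (RSpace.RegAt.id (X := triangleAmbient) T).snd.snd.fst

theorem regAt_sideArg (l : Fin 3) (T : TrianglePoint) : RSpace.RegAt triangleAmbient circle
    (fun T : TrianglePoint => tripleEquiv.symm T.2.2.2 l) T :=
  (regAt_tripleEquiv_symm l _).comp (RSpace.RegAt.id (X := triangleAmbient) T).snd.snd.snd

theorem isOpen_triangleDomain : IsOpen[triangleAmbient.top] (triangleDomain i e e') := by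
  have hshape : Continuous[triangleAmbient.top, (RSpace.projective ℝ (Fin 6 → ℝ)).top]
      fun T : TrianglePoint => T.2.2.1 :=
    RSpace.RegAt.continuous (X := triangleAmbient) (Y := .projective ℝ (Fin 6 → ℝ)) regAt_shape
  have harg : Continuous[triangleAmbient.top, circle.top]
      fun T : TrianglePoint => tripleEquiv.symm T.2.2.2 i :=
    RSpace.RegAt.continuous (X := triangleAmbient) (Y := circle) (regAt_sideArg i)
  have h1 := (RSpace.isOpen_nonvanishing (divRe e' ∘ₗ shapeSide (i + 1))).preimage hshape
  have h2 := (RSpace.isOpen_nonvanishing (shapeSide (i + 2))).preimage hshape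
  have h0 := (isOpen_slopeDomain (axis_ne_zero e)).preimage harg
  exact h1.inter (h2.inter h0)

theorem regAt_triangleCoords {T : TrianglePoint} (hT : T ∈ triangleDomain i e e') :
    RSpace.RegAt triangleAmbient (.affine (Fin 6 → ℝ)) (triangleCoords i e e') T := by
  obtain ⟨h1, -, h0⟩ := hT
  have hB := (RSpace.RegAt.id (X := triangleAmbient) T).fst
  have hside : RSpace.RegAt triangleAmbient (.affine ℂ)
      (fun T : TrianglePoint => T.2.1.1 (i + 1)) T :=
    RSpace.regAt_pi_iff.1 (RSpace.RegAt.id (X := triangleAmbient) T).snd.fst.val (i + 1)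
  refine RSpace.regAt_pi_iff.2 fun k => ?_
  fin_cases k
  · exact hB.linear Complex.reLm
  · exact hB.linear Complex.imLm
  · exact hside.linear (divRe e')
  · exact (RSpace.regAt_linRatio (divRe e ∘ₗ shapeSide i) h1).comp (regAt_shape T)
  · exact (RSpace.regAt_real_iff.2 (circle_reg_slope (axis_ne_zero e) h0)).comp (regAt_sideArg i T)
  · exact (RSpace.regAt_linRatio (divIm e' ∘ₗ shapeSide (i + 1)) h1).comp (regAt_shape T)

end triangleChart

theorem triangleSpace_isSmoothVariety : triangleSpace.IsSmoothVariety :=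
  RSpace.isSmoothVariety_of_charts triangleAmbient_separatesPoints
    (fun c : Fin 3 × axes × axes => triangleDomain c.1 c.2.1 c.2.2)
    (fun _ => isOpen_triangleDomain)
    (fun _ hT => let ⟨i, e, e', h⟩ := exists_mem_triangleDomain hT; ⟨(i, e, e'), h⟩)
    fun _ => RSpace.isSmoothAffine_of_chart (Ω := triangleAmbient) _
      (fun _ hx => regAt_triangleChart (by
        simpa only [eval_thirdSidePoly_ne_zero_iff, MvPolynomial.eval_X] using hx))
      (fun _ => regAt_triangleCoords) triangleChart_image
      fun x _ => triangleCoords_triangleChart x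

/-! ## The variety of triangle classes -/

/-- The points of the ambient space of the triangle classes. -/
abbrev ClassPoint : Type := projSideSet × torusSet

/-- The pair of the shape `[w]` and the angles enclosed by sides with arguments `η`. -/
noncomputable def mkClass (w : NonzeroSides) (η : Fin 3 → AddCircle Real.pi) : ClassPoint :=
  (⟨.mk ℂ w.1 w.2.1, w.1, w.2.1, rfl, w.2.2⟩,
    ⟨tripleEquiv fun l => η (l + 1) - η (l + 2),
      show (η 1 - η 2) + (η 2 - η 0) + (η 0 - η 1) = 0 by abel⟩)

theorem mkClass_angle (w : NonzeroSides) (η : Fin 3 → AddCircle Real.pi) (i : Fin 3) :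
    tripleEquiv.symm (mkClass w η).2.1 (i + 2) = η i - η (i + 1) := by
  fin_cases i <;> rfl

theorem mkClass_eq_of_smul {w w' : NonzeroSides} {c : ℂ} (h : w.1 = c • w'.1)
    (ξ : AddCircle Real.pi) (η : Fin 3 → AddCircle Real.pi) :
    mkClass w (fun l => ξ + η l) = mkClass w' η := by
  refine Prod.ext (Subtype.ext ?_) (Subtype.ext ?_)
  · exact (Projectivization.mk_eq_mk_iff' ..).2 ⟨c, h.symm⟩
  · simp only [mkClass, add_sub_add_left_eq_sub]

theorem mem_triangleClasses_iff {ω : ClassPoint} :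
    ω ∈ triangleClasses ↔ ∃ w η, IsArgOf w.1 η ∧ ω = mkClass w η := by
  constructor
  · obtain ⟨c, θ⟩ := ω
    rintro ⟨T, hT, ⟨v, hv, hv0, hshape, hc⟩, hα, hβ, hγ⟩
    obtain ⟨B, t, w, η, hη, rfl⟩ := exists_eq_mkTriangle hT
    obtain ⟨a, ha⟩ := (Projectivization.mk_eq_mk_iff' ..).1 hshape.symm
    refine ⟨w, η, hη, Prod.ext (Subtype.ext (hc.trans ?_))
      (Subtype.ext (Prod.ext hα (Prod.ext hβ hγ)))⟩
    refine (Projectivization.mk_eq_mk_iff' ..).2 ⟨(a : ℂ), ?_⟩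
    calc (a : ℂ) • w.1 = coordsEquiv (a • coordsEquiv.symm w.1) := by simp
      _ = complexCoords v := congrArg coordsEquiv ha
  · rintro ⟨w, η, hη, rfl⟩
    have hcoords : complexCoords (coordsEquiv.symm w.1) = w.1 := coordsEquiv.apply_symm_apply w.1
    refine ⟨_, mkTriangle_mem_triangles hη 0 0, ⟨coordsEquiv.symm w.1,
      coordsEquiv.symm.map_ne_zero_iff.2 w.2.1, hcoords.symm ▸ w.2.1, rfl, ?_⟩, rfl, rfl, rfl⟩
    simp only [hcoords]

theorem exists_normalized_eq_mkClass {ω : ClassPoint} (hω : ω ∈ triangleClasses) {i : Fin 3}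
    (hi : ω.1.1 ∈ RSpace.nonvanishing (LinearMap.proj (R := ℂ) i)) :
    ∃ w η, IsArgOf w.1 η ∧ w.1 i = 1 ∧ η i = 0 ∧ ω = mkClass w η := by
  obtain ⟨w, η, hη, rfl⟩ := mem_triangleClasses_iff.1 hω
  have hwi : w.1 i ≠ 0 := RSpace.mk_mem_nonvanishing.1 hi
  have hc : (w.1 i)⁻¹ ≠ 0 := inv_ne_zero hwi
  let w' : NonzeroSides :=
    ⟨(w.1 i)⁻¹ • w.1, smul_ne_zero hc w.2.1, by simp [← mul_add, w.2.2]⟩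
  have hone : w'.1 i = 1 := inv_mul_cancel₀ hwi
  have hη' : IsArgOf w'.1 _ := hη.smul hc
  refine ⟨w', _, hη', hone, ?_, (mkClass_eq_of_smul (w := w') rfl _ η).symm⟩
  rw [hη' i (hone ▸ one_ne_zero), hone, argModPi_one]

theorem RSpace.RegAt.mkClass {X : RSpace} {x : X} {w : X → NonzeroSides}
    {η : X → Fin 3 → AddCircle Real.pi}
    (hw : RegAt X (affine (Fin 3 → ℂ)) (fun y => (w y).1) x)
    (hη : ∀ k l, RegAt X circle (fun y => η y k - η y l) x) :
    RegAt X classAmbient (fun y => TriangleModuli.mkClass (w y) (η y)) x := by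
  have hshape : RegAt X projSideVectors (fun y => (TriangleModuli.mkClass (w y) (η y)).1) x :=
    .codRestrict (hw.projectivizationMk fun y => (w y).2.1)
  have hangles : RegAt X torus (fun y => (TriangleModuli.mkClass (w y) (η y)).2) x :=
    .codRestrict (.tripleEquiv fun l => hη (l + 1) (l + 2))
  exact hshape.prodMk hangles

theorem classAmbient_separatesPoints : classAmbient.SeparatesPoints :=
  ((RSpace.SeparatesPoints.projective ℂ (Fin 3 → ℂ)).sub _).prod (circle3_separatesPoints.sub _)

/-- The class with coordinates `x`, in which the side `i + 1` is scaled to `1`. -/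
noncomputable def classChart (i : Fin 3) (e : axes) (x : Fin 2 → ℝ) : ClassPoint :=
  mkClass (normalSides i e realAxis (x 0) (x 1) 0)
    fun l => argModPi (normalDirs i e realAxis (x 0) (x 1) 0 l)

/-- The domain of the coordinates `classCoords`: the sides `i + 1` and `i + 2` do not vanish, and
the angle between the sides `i` and `i + 1` has a finite slope relative to `e`. -/
def classDomain (i : Fin 3) (e : axes) : Set ClassPoint :=
  {ω | ω.1.1 ∈ RSpace.nonvanishing (LinearMap.proj (R := ℂ) (i + 1)) ∧
    ω.1.1 ∈ RSpace.nonvanishing (LinearMap.proj (R := ℂ) (i + 2)) ∧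
    tripleEquiv.symm ω.2.1 (i + 2) ∈ slopeDomain e}

/-- The inverse of `classChart` on `classDomain`. -/
noncomputable def classCoords (i : Fin 3) (e : axes) (ω : ClassPoint) : Fin 2 → ℝ :=
  ![divRe e (RSpace.linRatio (LinearMap.proj i) (LinearMap.proj (R := ℂ) (i + 1)) ω.1.1),
    slope e (tripleEquiv.symm ω.2.1 (i + 2))]

section classChart

variable {i : Fin 3} {e : axes}

theorem mkClass_mem_classDomain {w : NonzeroSides} {η : Fin 3 → AddCircle Real.pi} :
    mkClass w η ∈ classDomain i e ↔
      w.1 (i + 1) ≠ 0 ∧ w.1 (i + 2) ≠ 0 ∧ η i - η (i + 1) ∈ slopeDomain e := by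
  rw [← mkClass_angle w]
  exact and_congr RSpace.mk_mem_nonvanishing (and_congr_left' RSpace.mk_mem_nonvanishing)

theorem classChart_angle (x : Fin 2 → ℝ) :
    tripleEquiv.symm (classChart i e x).2.1 (i + 2) = argModPi (slopeVec e (x 1)) := by
  rw [classChart, mkClass_angle]
  simp [normalDirs, slopeVec_realAxis_zero, argModPi_one]

theorem classCoords_classChart (x : Fin 2 → ℝ) : classCoords i e (classChart i e x) = x := by
  have he := axis_ne_zero e
  have hshape : RSpace.linRatio (LinearMap.proj i) (LinearMap.proj (R := ℂ) (i + 1))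
      (classChart i e x).1.1 = x 0 • slopeVec e (x 1) := by
    simp [classChart, mkClass, RSpace.linRatio_mk, normalSides, slopeVec_realAxis_zero]
  funext k
  fin_cases k
  · simp [classCoords, hshape, divRe_slopeVec he, -Complex.real_smul]
  · simp [classCoords, classChart_angle, slope_argModPi_slopeVec he]

theorem classChart_image :
    classChart i e '' {x | MvPolynomial.eval x (thirdSidePoly e realAxis (.X 0) (.X 1) 0) ≠ 0} =
      triangleClasses ∩ classDomain i e := by
  simp only [eval_thirdSidePoly_ne_zero_iff, MvPolynomial.eval_X, map_zero]
  refine Set.Subset.antisymm ?_ ?_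
  · rintro _ ⟨x, hx, rfl⟩
    refine ⟨mem_triangleClasses_iff.2 ⟨_, _, isArgOf_normalSides _ _ _, rfl⟩,
      mkClass_mem_classDomain.2 ⟨?_, ?_, ?_⟩⟩
    · simp [normalSides, slopeVec_realAxis_zero]
    · simpa [normalSides] using hx
    · simpa [normalDirs, slopeVec_realAxis_zero, argModPi_one] using
        argModPi_slopeVec_mem_slopeDomain (axis_ne_zero e) (x 1)
  · rintro ω ⟨hω, hU⟩
    obtain ⟨w, η, hη, hw1, hη1, rfl⟩ := exists_normalized_eq_mkClass hω hU.1
    obtain ⟨-, h2, h0⟩ := mkClass_mem_classDomain.1 hU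
    rw [hη1, sub_zero] at h0
    obtain ⟨ρ, r, m, m', hne, hw, rfl⟩ := hη.exists_eq_normalSides (e' := realAxis) h0
      (by simp [hw1, divRe_apply, realAxis]) h2
    obtain ⟨rfl, rfl⟩ : ρ = 1 ∧ m' = 0 := by
      have h : ρ • slopeVec realAxis m' = slopeVec realAxis 0 := by
        simpa [hw, normalSides, slopeVec_realAxis_zero] using hw1
      have hre := congrArg (divRe realAxis) h
      have him := congrArg (divIm realAxis) h
      simp only [map_smul, divRe_slopeVec (axis_ne_zero _), divIm_slopeVec (axis_ne_zero _),
        smul_eq_mul, mul_one] at hre him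
      exact ⟨hre, by simpa [hre] using him⟩
    rw [one_smul] at hw
    exact ⟨![r, m], hne, by rw [Subtype.ext hw]; rfl⟩

theorem exists_mem_classDomain {ω : ClassPoint} (hω : ω ∈ triangleClasses) :
    ∃ i e, ω ∈ classDomain i e := by
  obtain ⟨w, η, -, rfl⟩ := mem_triangleClasses_iff.1 hω
  obtain ⟨i, h1, h2⟩ := w.exists_two_ne_zero
  obtain ⟨e, he⟩ := exists_axis_mem_slopeDomain (η i - η (i + 1))
  exact ⟨i, e, mkClass_mem_classDomain.2 ⟨h1, h2, he⟩⟩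

theorem regAt_classChart {x : Fin 2 → ℝ} (hx : thirdSide e realAxis (x 0) (x 1) 0 ≠ 0) :
    RSpace.RegAt (.affine (Fin 2 → ℝ)) classAmbient (classChart i e) x := by
  have hcoord : ∀ k, (RSpace.affine (Fin 2 → ℝ)).Reg (fun y : Fin 2 → ℝ => y k) x := fun k =>
    RSpace.regAt_real_iff.1 (RSpace.regAt_pi_iff.1 (.id x) k)
  have hzero := (RSpace.affine (Fin 2 → ℝ)).reg_const 0 x
  have hdirs := RSpace.RegAt.normalDirs (hcoord 0) (hcoord 1) hzero i e realAxis
  exact .mkClass (.normalSides (hcoord 0) (hcoord 1) hzero i e realAxis) fun k l =>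
    (hdirs k).argModPi_sub_argModPi (hdirs l) (normalDirs_ne_zero hx k) (normalDirs_ne_zero hx l)

theorem regAt_classShape (ω : ClassPoint) : RSpace.RegAt classAmbient
    (.projective ℂ (Fin 3 → ℂ)) (fun ω : ClassPoint => ω.1.1) ω :=
  (RSpace.RegAt.id (X := classAmbient) ω).fst.val

theorem regAt_classAngle (l : Fin 3) (ω : ClassPoint) : RSpace.RegAt classAmbient circle
    (fun ω : ClassPoint => tripleEquiv.symm ω.2.1 l) ω :=
  (regAt_tripleEquiv_symm l _).comp (RSpace.RegAt.id (X := classAmbient) ω).snd.val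

theorem isOpen_classDomain : IsOpen[classAmbient.top] (classDomain i e) := by
  have hshape : Continuous[classAmbient.top, (RSpace.projective ℂ (Fin 3 → ℂ)).top]
      fun ω : ClassPoint => ω.1.1 :=
    RSpace.RegAt.continuous (X := classAmbient) (Y := .projective ℂ (Fin 3 → ℂ)) regAt_classShape
  have hangle : Continuous[classAmbient.top, circle.top]
      fun ω : ClassPoint => tripleEquiv.symm ω.2.1 (i + 2) :=
    RSpace.RegAt.continuous (X := classAmbient) (Y := circle) (regAt_classAngle (i + 2))
  have h1 := (RSpace.isOpen_nonvanishing (LinearMap.proj (R := ℂ) (i + 1))).preimage hshape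
  have h2 := (RSpace.isOpen_nonvanishing (LinearMap.proj (R := ℂ) (i + 2))).preimage hshape
  have h0 := (isOpen_slopeDomain (axis_ne_zero e)).preimage hangle
  exact h1.inter (h2.inter h0)

theorem regAt_classCoords {ω : ClassPoint} (hω : ω ∈ classDomain i e) :
    RSpace.RegAt classAmbient (.affine (Fin 2 → ℝ)) (classCoords i e) ω := by
  obtain ⟨h1, -, h0⟩ := hω
  refine RSpace.regAt_pi_iff.2 (Fin.forall_fin_two.2 ⟨?_, ?_⟩)
  · exact ((RSpace.regAt_linRatio (LinearMap.proj i) h1).comp (regAt_classShape ω)).linear (divRe e)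
  · exact (RSpace.regAt_real_iff.2 (circle_reg_slope (axis_ne_zero e) h0)).comp
      (regAt_classAngle (i + 2) ω)

end classChart

theorem classSpace_isSmoothVariety : classSpace.IsSmoothVariety :=
  RSpace.isSmoothVariety_of_charts classAmbient_separatesPoints
    (fun c : Fin 3 × axes => classDomain c.1 c.2)
    (fun _ => isOpen_classDomain)
    (fun _ hω => let ⟨i, e, h⟩ := exists_mem_classDomain hω; ⟨(i, e), h⟩)
    fun _ => RSpace.isSmoothAffine_of_chart (Ω := classAmbient) _
      (fun _ hx => regAt_classChart (by
        simpa only [eval_thirdSidePoly_ne_zero_iff, MvPolynomial.eval_X, map_zero] using hx))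
      (fun _ => regAt_classCoords) classChart_image
      fun x _ => classCoords_classChart x

end TriangleModuli

open TriangleModuli in
/-- The spaces of triangles and of triangle classes are smooth real varieties; they represent the
moduli functors of triangles and of triangle classes, with the tautological families as universal
families. -/
theorem theorem6p1 :
    (∃ hT : triangleSpace.IsSmoothVariety,
      IsFineModuliSpace triangleFunctor ⟨triangleSpace, hT⟩
        (tautologicalFamily triangleAmbient triangles hT)) ∧
    (∃ hD : classSpace.IsSmoothVariety,
      IsFineModuliSpace classFunctor ⟨classSpace, hD⟩
        (tautologicalFamily classAmbient triangleClasses hD)) :=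
  ⟨⟨triangleSpace_isSmoothVariety, isFineModuliSpace_tautologicalFamily _⟩,
    ⟨classSpace_isSmoothVariety, isFineModuliSpace_tautologicalFamily _⟩⟩
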